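/- All codes are binary linear codes, i.e. linear subspaces $C\le\mathbb F_2^n$; an $[n,k]$ code has length $n$ and dimension $k$. A code is \emph{projective} if it has no position at which all codewords vanish and no two distinct positions at which all codewords agree, and \emph{$\Delta$-divisible} if all its Hamming weights are divisible by $\Delta$. Write $C\cong_0 D$ if, after deleting from each code all positions at which all its codewords vanish, the two codes agree up to a bijection of the positions. Let $m\cdot C$ denote the $m$-fold repetition of $C$, $\oplus$ the direct sum of codes, and $\mathbf 0$ the zero code. Let $\mathrm{Sim}_2(k)$ (for $k\ge 1$) be the simplex code, spanned by the rows of the matrix whose columns are all non-zero vectors of $\mathbb F_2^k$; let $\mathrm{RM}_2(k)$ (for $k\ge 2$) be the first order Reed--Muller code of length $2^{k-1}$ and dimension $k$, spanned by the rows of the matrix whose columns are all vectors of $\mathbb F_2^{k-1}$, extended by an all-one row; and let $\mathrm{PC}_2(k)=\{c\in\mathbb F_2^{k+1} : c_1+\dots+c_{k+1}=0\}$ be the parity check code. Let $a\ge 0$ be an integer, $\Delta=2^a$, and let $C$ be a binary projective $\Delta$-divisible $[4\Delta,k]$ code containing the all-one word. Let $C'$ be the subcode of $C$ spanned by all codewords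 of weight $\Delta$. Then exactly one of the following four cases holds: (i) $a\ge 1$, $C'\cong_0\frac{\Delta}{2}\cdot\mathrm{PC}_2(7)$ and $k=a+6$; (ii) $C'\cong_0\frac{\Delta}{2^{\ell-2}}\cdot\mathrm{RM}_2(\ell)\oplus\frac{\Delta}{2^{\ell-2}}\cdot\mathrm{RM}_2(\ell)$ and $k=a+\ell+2$ for some $\ell\in\{2,\dots,a+2\}$; (iii) $a\ge 1$, $C'\cong_0\frac{\Delta}{2}\cdot\mathrm{Sim}_2(2)\oplus\Delta\cdot\mathrm{Sim}_2(1)$ and $k=a+4$; (iv) $C'\cong_0\mathbf 0$ (that is, $C'$ is the zero code) and $k=a+3$. -/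

import Mathlib

/-- A binary linear code whose positions are indexed by `ι`. For `ι = Fin n` it is a code
of length `n`. -/
abbrev BinaryCode (ι : Type) : Type := Submodule (ZMod 2) (ι → ZMod 2)

namespace BinaryCode

variable {ι κ : Type}

/-- The support of a code: all positions at which some codeword is non-zero. -/
def supp (C : BinaryCode ι) : Set ι := {i | ∃ c ∈ C, c i ≠ 0}

/-- There are no zero positions. -/
def FullLength (C : BinaryCode ι) : Prop := ∀ i, i ∈ C.supp

/-- Full-length and of maximum multiplicity at most one. Over the field with two elements two
positions are (projectively) equivalent iff they agree in every codeword. -/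
def Projective (C : BinaryCode ι) : Prop :=
  C.FullLength ∧ ∀ i j, (∀ c ∈ C, c i = c j) → i = j

/-- All Hamming weights are divisible by `Δ`. -/
def Divisible [Fintype ι] (Δ : ℕ) (C : BinaryCode ι) : Prop :=
  ∀ c ∈ C, Δ ∣ hammingNorm c

/-- The subcode spanned by all codewords of Hamming weight `w`. -/
def weightSubcode [Fintype ι] (C : BinaryCode ι) (w : ℕ) : BinaryCode ι :=
  Submodule.span (ZMod 2) {c | c ∈ C ∧ hammingNorm c = w}

/-- The restriction of a code to the positions in `I`. -/
def restrict (C : BinaryCode ι) (I : Set ι) : BinaryCode I :=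
  C.map (LinearMap.funLeft (ZMod 2) (ZMod 2) (Subtype.val : I → ι))

/-- Two binary codes are isomorphic if a bijection of the positions maps one onto the other. -/
def Iso (C : BinaryCode ι) (D : BinaryCode κ) : Prop :=
  ∃ e : κ ≃ ι, C.map (LinearMap.funLeft (ZMod 2) (ZMod 2) e) = D

/-- Two binary codes are isomorphic after removing all zero positions. -/
def IsoZero (C : BinaryCode ι) (D : BinaryCode κ) : Prop :=
  Iso (C.restrict C.supp) (D.restrict D.supp)

/-- The direct sum: all words `(c, d)` with `c ∈ C` and `d ∈ D`. -/
def directSum (C : BinaryCode ι) (D : BinaryCode κ) : BinaryCode (ι ⊕ κ) :=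
  C.comap (LinearMap.funLeft (ZMod 2) (ZMod 2) Sum.inl) ⊓
    D.comap (LinearMap.funLeft (ZMod 2) (ZMod 2) Sum.inr)

/-- The `m`-fold repetition of a code: each position is repeated `m` times. -/
def rep (m : ℕ) (C : BinaryCode ι) : BinaryCode (ι × Fin m) :=
  C.map (LinearMap.funLeft (ZMod 2) (ZMod 2) Prod.fst)

/-- The code spanned by the rows of a generator matrix. -/
def rowSpan (G : Matrix κ ι (ZMod 2)) : BinaryCode ι :=
  Submodule.span (ZMod 2) (Set.range fun r => G r)

/-- The binary simplex code of dimension `k`: the columns of the generator matrix are all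
non-zero vectors of `𝔽₂ᵏ`. -/
def Sim (k : ℕ) : BinaryCode {v : Fin k → ZMod 2 // v ≠ 0} :=
  rowSpan (Matrix.of fun (r : Fin k) v => v.1 r)

/-- The binary first order Reed-Muller code of dimension `k` (for `1 ≤ k`): the columns of the
generator matrix are all vectors of `𝔽₂ᵏ⁻¹`, extended by an all-one row. -/
def RM (k : ℕ) : BinaryCode (Fin (k - 1) → ZMod 2) :=
  rowSpan (Matrix.of fun (r : Fin (k - 1) ⊕ Unit) v => Sum.elim (fun s => v s) (fun _ => 1) r)

/-- The binary parity check code of dimension `k` and length `k + 1`. -/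
def PC (k : ℕ) : BinaryCode (Fin (k + 1)) where
  carrier := {c | ∑ i, c i = 0}
  zero_mem' := by simp
  add_mem' := by
    intro x y hx hy
    simp only [Set.mem_ofPred_eq] at hx hy ⊢
    simp [Finset.sum_add_distrib, hx, hy]
  smul_mem' := by
    intro t x hx
    simp only [Set.mem_ofPred_eq] at hx ⊢
    simp [← Finset.mul_sum, hx]

end BinaryCode

open BinaryCode

/-! Write D for 2^a. A second moment computation over a projective code shows that A, the number of
words of weight D, satisfies A + 4 = 2^j with k = a + 1 + j (`ncard_hasWeight_add_four`). By
divisibility, two distinct words of weight D are either disjoint or share exactly D/2 positions, and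
then their sum has weight D again (`HasWeight.mul_eq_zero_or`). These two facts drive the
classification.

Call disjoint words of weight D/2 with pairwise sums in C blocks. Five blocks extend to a maximal
family, and counting forces exactly eight, whose pair sums are all the words of weight D: this is
(i). If some word U of weight 2D contains a word of weight D, and every such word lies inside U or
avoids it, the words on each side together with 0 and U (or its complement) form a code; the two
dimensions agree since A + 4 is a power of two: this is (ii).

Otherwise two words meeting a common word must meet each other, since a violation produces five
blocks. So the words of weight D fall into mutually disjoint clusters, each the nonzero part of a
constant weight code. Length and the condition on A + 4 leave no cluster, (iv), or two of dimensions
2 and 1, (iii).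

In each case the structure is first found as a vector space with weights; the MacWilliams theorem
(`isoZero_range_of_hammingNorm_eq`) turns that into a bijection of positions. The cases exclude one
another because dim C' is 7, an even number 2ℓ ≥ 4, 3 and 0 respectively. -/

namespace BinaryCode

/-! ### Character sums. -/

variable {ι κ : Type}

/-- The nontrivial additive character of the field with two elements. -/
def sgn (a : ZMod 2) : ℤ := if a = 0 then 1 else -1

lemma sgn_add : ∀ a b : ZMod 2, sgn (a + b) = sgn a * sgn b := by decide

lemma sgn_eq : ∀ a : ZMod 2, sgn a = 1 - 2 * (if a ≠ 0 then 1 else 0) := by decide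

lemma sum_sgn_linear {V : Type*} [AddCommGroup V] [Module (ZMod 2) V] [Fintype V]
    (f : V →ₗ[ZMod 2] ZMod 2) [Decidable (f = 0)] :
    ∑ v, sgn (f v) = if f = 0 then (Fintype.card V : ℤ) else 0 := by
  split_ifs with h
  · simp [h, sgn]
  · obtain ⟨v₀, hv₀⟩ : ∃ v, f v ≠ 0 := by
      by_contra! hc
      exact h (LinearMap.ext hc)
    have h1 : ∑ v, sgn (f (v + v₀)) = ∑ v, sgn (f v) :=
      Equiv.sum_comp (Equiv.addRight v₀) fun v => sgn (f v)
    have h2 : sgn (f v₀) = -1 := by simp [sgn, hv₀]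
    simp only [map_add, sgn_add, h2, ← Finset.sum_mul] at h1
    linarith

lemma sum_sgn [Fintype ι] (c : ι → ZMod 2) :
    ∑ i, sgn (c i) = (Fintype.card ι : ℤ) - 2 * hammingNorm c := by
  simp only [sgn_eq, Finset.sum_sub_distrib, ← Finset.mul_sum, Finset.sum_boole, hammingNorm]
  simp

lemma mem_supp_range {V : Type*} [AddCommGroup V] [Module (ZMod 2) V]
    (φ : V →ₗ[ZMod 2] ι → ZMod 2) (i : ι) :
    i ∈ supp (LinearMap.range φ) ↔ LinearMap.proj i ∘ₗ φ ≠ 0 := by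
  constructor
  · rintro ⟨_, ⟨v, rfl⟩, hv⟩ h
    exact hv (LinearMap.congr_fun h v)
  · intro h
    by_contra hc
    refine h (LinearMap.ext fun v => ?_)
    by_contra hv
    exact hc ⟨φ v, ⟨v, rfl⟩, hv⟩

/-! ### The MacWilliams extension theorem. -/

section MacWilliams

variable {V : Type*} [AddCommGroup V] [Module (ZMod 2) V] [Fintype V]
  [Fintype ι] [Fintype κ]

/-- Fourier inversion: summing the character of f plus coordinate i over V detects whether that
coordinate is f. Hence the weight function alone determines how often each nonzero functional occurs
as a coordinate. -/
lemma card_mul_card_fiber (φ : V →ₗ[ZMod 2] ι → ZMod 2) (f : V →ₗ[ZMod 2] ZMod 2) (hf : f ≠ 0)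
    [DecidablePred fun i => LinearMap.proj i ∘ₗ φ = f] :
    (Fintype.card V : ℤ) * Fintype.card {i // LinearMap.proj i ∘ₗ φ = f} =
      - 2 * ∑ v, sgn (f v) * hammingNorm (φ v) := by
  classical
  have h1 : ∑ v, sgn (f v) * ∑ i, sgn (φ v i) =
      - 2 * ∑ v, sgn (f v) * (hammingNorm (φ v) : ℤ) := by
    have h0 := sum_sgn_linear f
    rw [if_neg hf] at h0
    simp only [sum_sgn, mul_sub, Finset.sum_sub_distrib, ← Finset.sum_mul, h0]
    rw [Finset.mul_sum]
    simp only [zero_mul, zero_sub, ← Finset.sum_neg_distrib]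
    refine Finset.sum_congr rfl fun v _ => by ring
  rw [← h1]
  simp only [Finset.mul_sum, ← sgn_add]
  rw [Finset.sum_comm]
  have h2 : ∀ i, ∑ v, sgn (f v + φ v i) =
      if LinearMap.proj i ∘ₗ φ = f then (Fintype.card V : ℤ) else 0 := by
    intro i
    have := sum_sgn_linear (f + LinearMap.proj i ∘ₗ φ)
    simp only [LinearMap.add_apply, LinearMap.comp_apply, LinearMap.proj_apply] at this
    rw [this]
    congr 1
    rw [← eq_iff_iff.symm]
    constructor
    · intro h
      ext v
      have := LinearMap.congr_fun h v
      simp only [LinearMap.add_apply, LinearMap.zero_apply] at this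
      exact (CharTwo.add_eq_zero.1 this).symm
    · rintro rfl
      ext v
      simp [CharTwo.add_self_eq_zero]
  simp only [h2, Finset.sum_ite, Finset.sum_const_zero, add_zero, Finset.sum_const,
    Fintype.card_subtype, nsmul_eq_mul]
  ring

/-- The MacWilliams extension theorem for binary codes. -/
theorem isoZero_range_of_hammingNorm_eq (φ : V →ₗ[ZMod 2] ι → ZMod 2)
    (ψ : V →ₗ[ZMod 2] κ → ZMod 2) (h : ∀ v, hammingNorm (φ v) = hammingNorm (ψ v)) :
    IsoZero (LinearMap.range φ) (LinearMap.range ψ) := by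
  classical
  have hfib : ∀ f : V →ₗ[ZMod 2] ZMod 2, f ≠ 0 →
      Nonempty ({j // LinearMap.proj j ∘ₗ ψ = f} ≃ {i // LinearMap.proj i ∘ₗ φ = f}) := by
    intro f hf
    refine ⟨Fintype.equivOfCardEq ?_⟩
    have h1 := card_mul_card_fiber φ f hf
    have h2 := card_mul_card_fiber ψ f hf
    simp only [h] at h1
    rw [← h2] at h1
    have : (Fintype.card V : ℤ) ≠ 0 := by exact_mod_cast Fintype.card_ne_zero
    exact_mod_cast (mul_left_cancel₀ this h1).symm
  let p : supp (LinearMap.range φ) → {f : V →ₗ[ZMod 2] ZMod 2 // f ≠ 0} :=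
    fun i => ⟨LinearMap.proj i.1 ∘ₗ φ, (mem_supp_range φ _).1 i.2⟩
  let q : supp (LinearMap.range ψ) → {f : V →ₗ[ZMod 2] ZMod 2 // f ≠ 0} :=
    fun i => ⟨LinearMap.proj i.1 ∘ₗ ψ, (mem_supp_range ψ _).1 i.2⟩
  have hpq : ∀ f, Nonempty ({j // q j = f} ≃ {i // p i = f}) := by
    intro f
    have e1 : {j // q j = f} ≃ {j // LinearMap.proj j ∘ₗ ψ = f.1} :=
      { toFun := fun j => ⟨j.1.1, congrArg Subtype.val j.2⟩
        invFun := fun j => ⟨⟨j.1, (mem_supp_range ψ _).2 (by rw [j.2]; exact f.2)⟩,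
          Subtype.ext j.2⟩
        left_inv := fun j => rfl
        right_inv := fun j => rfl }
    have e2 : {i // p i = f} ≃ {i // LinearMap.proj i ∘ₗ φ = f.1} :=
      { toFun := fun j => ⟨j.1.1, congrArg Subtype.val j.2⟩
        invFun := fun j => ⟨⟨j.1, (mem_supp_range φ _).2 (by rw [j.2]; exact f.2)⟩,
          Subtype.ext j.2⟩
        left_inv := fun j => rfl
        right_inv := fun j => rfl }
    exact (hfib f.1 f.2).map fun E => e1.trans (E.trans e2.symm)
  -- Equal multiplicities give bijections over each functional; they are glued to one bijection of
  -- the supports.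
  let e : supp (LinearMap.range ψ) ≃ supp (LinearMap.range φ) :=
    Equiv.ofFiberEquiv fun f => (hpq f).some
  have he : ∀ j, p (e j) = q j := fun j => Equiv.ofFiberEquiv_map _ _
  have hval : ∀ j v, φ v (e j).1 = ψ v j.1 := fun j v =>
    LinearMap.congr_fun (congrArg Subtype.val (he j)) v
  refine ⟨e, ?_⟩
  rw [restrict, restrict, ← LinearMap.range_comp, ← LinearMap.range_comp, ← LinearMap.range_comp]
  congr 1
  ext v j
  exact hval j v

end MacWilliams

/-! ### Second moments of the weights. -/

/-- The expanded square is a sum over pairs of positions, and orthogonality kills every pair that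
some word of W separates. -/
lemma sum_sq_sum_sgn [Fintype ι] (W : BinaryCode ι) [Fintype W] (I : Finset ι)
    [DecidablePred fun p : ι × ι => ∀ w ∈ W, w p.1 = w p.2] :
    ∑ w : W, (∑ i ∈ I, sgn (w.1 i)) ^ 2 =
      (Fintype.card W : ℤ) * ((I ×ˢ I).filter fun p => ∀ w ∈ W, w p.1 = w p.2).card := by
  classical
  have h1 : ∀ w : W, (∑ i ∈ I, sgn (w.1 i)) ^ 2 =
      ∑ p ∈ I ×ˢ I, sgn (w.1 p.1 + w.1 p.2) := by
    intro w
    simp only [sq, Finset.sum_mul_sum, ← Finset.sum_product', ← sgn_add]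
  simp only [h1]
  rw [Finset.sum_comm]
  have h2 : ∀ p : ι × ι, ∑ w : W, sgn (w.1 p.1 + w.1 p.2) =
      if (∀ w ∈ W, w p.1 = w p.2) then (Fintype.card W : ℤ) else 0 := by
    intro p
    have := sum_sgn_linear ((LinearMap.proj (R := ZMod 2) (φ := fun _ : ι => ZMod 2) p.1 +
      LinearMap.proj (R := ZMod 2) (φ := fun _ : ι => ZMod 2) p.2) ∘ₗ W.subtype)
    simp only [LinearMap.add_apply, LinearMap.comp_apply, LinearMap.proj_apply,
      Submodule.subtype_apply] at this
    rw [this]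
    congr 1
    rw [← eq_iff_iff.symm]
    constructor
    · intro h w hw
      exact CharTwo.add_eq_zero.1 (LinearMap.congr_fun h ⟨w, hw⟩)
    · intro h
      ext w
      exact CharTwo.add_eq_zero.2 (h _ w.2)
  simp only [h2, Finset.sum_ite, Finset.sum_const_zero, add_zero, Finset.sum_const, nsmul_eq_mul]
  ring

lemma card_mul_le_sum_sq_sum_sgn [Fintype ι] (W : BinaryCode ι) [Fintype W] (I : Finset ι) :
    (Fintype.card W : ℤ) * I.card ≤ ∑ w : W, (∑ i ∈ I, sgn (w.1 i)) ^ 2 := by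
  classical
  rw [sum_sq_sum_sgn]
  gcongr
  rw [← Finset.diag_card I]
  refine Finset.card_le_card fun p hp => ?_
  rw [Finset.mem_diag] at hp
  simp [hp.1, ← hp.2]

lemma Projective.sum_sq_eq [Fintype ι] {C : BinaryCode ι} [Fintype C] (hC : C.Projective) :
    ∑ c : C, ((Fintype.card ι : ℤ) - 2 * hammingNorm c.1) ^ 2 =
      (Fintype.card C : ℤ) * Fintype.card ι := by
  classical
  simp only [← sum_sgn]
  rw [sum_sq_sum_sgn]
  congr 2
  rw [← Finset.card_univ (α := ι), ← Finset.diag_card (Finset.univ : Finset ι)]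
  congr 1
  ext p
  simp only [Finset.mem_filter, Finset.mem_product, Finset.mem_univ, Finset.mem_diag, true_and]
  exact ⟨hC.2 _ _, fun h w _ => by rw [h]⟩

/-! ### Words as indicator functions: products are intersections of supports. -/

section Words

lemma mul_self_word (x : ι → ZMod 2) : x * x = x := by
  funext i
  simp only [Pi.mul_apply]
  generalize x i = a
  revert a
  decide

lemma add_eq_zero_iff_word {x y : ι → ZMod 2} : x + y = 0 ↔ x = y := by
  rw [add_eq_zero_iff_eq_neg, ZModModule.neg_eq_self]

lemma hammingNorm_add_add [Fintype ι] (x y : ι → ZMod 2) :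
    hammingNorm (x + y) + 2 * hammingNorm (x * y) = hammingNorm x + hammingNorm y := by
  classical
  have h : ∀ a b : ZMod 2, (if a + b ≠ 0 then 1 else 0) + 2 * (if a * b ≠ 0 then 1 else 0) =
    (if a ≠ 0 then 1 else 0) + (if b ≠ 0 then 1 else 0) := by decide
  simp only [hammingNorm, Finset.card_filter, Finset.mul_sum, ← Finset.sum_add_distrib,
    Pi.add_apply, Pi.mul_apply, h]

lemma hammingNorm_add_of_mul_eq_zero [Fintype ι] {x y : ι → ZMod 2} (h : x * y = 0) :
    hammingNorm (x + y) = hammingNorm x + hammingNorm y := by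
  have := hammingNorm_add_add x y
  simpa [h] using this

lemma hammingNorm_mul_le [Fintype ι] (x y : ι → ZMod 2) :
    hammingNorm (x * y) ≤ hammingNorm x := by
  classical
  refine Finset.card_le_card fun i hi => ?_
  simp only [Finset.mem_filter, Finset.mem_univ, true_and, Pi.mul_apply] at hi ⊢
  exact left_ne_zero_of_mul hi

/-- Containment of supports is expressed by `x * y = x` throughout; here it follows from a
cardinality. -/
lemma mul_eq_of_hammingNorm_eq [Fintype ι] {x y : ι → ZMod 2}
    (h : hammingNorm (x * y) = hammingNorm x) : x * y = x := by
  have h1 := hammingNorm_add_add x (x * y)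
  rw [← mul_assoc, mul_self_word, h] at h1
  have h2 : x + x * y = 0 := hammingNorm_eq_zero.1 (by omega)
  exact (add_eq_zero_iff_word.1 h2).symm

lemma hammingNorm_sum_of_pairwise [Fintype ι] {α : Type*} (s : Finset α) (f : α → ι → ZMod 2)
    (h : (s : Set α).Pairwise fun i j => f i * f j = 0) :
    hammingNorm (∑ i ∈ s, f i) = ∑ i ∈ s, hammingNorm (f i) := by
  classical
  induction s using Finset.induction_on with
  | empty => simp
  | insert b s hb ih =>
    rw [Finset.sum_insert hb, Finset.sum_insert hb, hammingNorm_add_of_mul_eq_zero, ih]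
    · exact h.mono (by simp)
    · rw [Finset.mul_sum]
      refine Finset.sum_eq_zero fun i hi => h (by simp) (by simp [hi]) ?_
      rintro rfl
      exact hb hi

end Words

/-! ### Weight isometries, direct sums and repetitions. -/

/-- The codes are isomorphic as vector spaces with a weight function. -/
def WeightEquiv [Fintype ι] [Fintype κ] (C : BinaryCode ι) (D : BinaryCode κ) : Prop :=
  ∃ f : C ≃ₗ[ZMod 2] D, ∀ c, hammingNorm (f c).1 = hammingNorm c.1

lemma isoZero_sup_directSum {κ₁ κ₂ : Type} [Fintype ι] [Fintype κ₁] [Fintype κ₂]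
    {W₁ W₂ : BinaryCode ι} {D₁ : BinaryCode κ₁} {D₂ : BinaryCode κ₂}
    (h₁ : WeightEquiv W₁ D₁) (h₂ : WeightEquiv W₂ D₂)
    (hW : ∀ x ∈ W₁, ∀ y ∈ W₂, x * y = 0) : IsoZero (W₁ ⊔ W₂) (directSum D₁ D₂) := by
  classical
  obtain ⟨f₁, hf₁⟩ := h₁
  obtain ⟨f₂, hf₂⟩ := h₂
  let φ : (W₁ × W₂) →ₗ[ZMod 2] ι → ZMod 2 := W₁.subtype.coprod W₂.subtype
  let ψ : (W₁ × W₂) →ₗ[ZMod 2] κ₁ ⊕ κ₂ → ZMod 2 :=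
    (LinearEquiv.sumArrowLequivProdArrow κ₁ κ₂ (ZMod 2) (ZMod 2)).symm.toLinearMap ∘ₗ
      (D₁.subtype ∘ₗ f₁.toLinearMap).prodMap (D₂.subtype ∘ₗ f₂.toLinearMap)
  have hψ : ∀ v, ψ v = Sum.elim (f₁ v.1).1 (f₂ v.2).1 := by
    intro v
    ext (i | i) <;> rfl
  have e1 : LinearMap.range φ = W₁ ⊔ W₂ := by
    simp [φ, LinearMap.range_coprod]
  have e2 : LinearMap.range ψ = directSum D₁ D₂ := by
    ext d
    constructor
    · rintro ⟨v, rfl⟩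
      rw [hψ]
      exact ⟨(f₁ v.1).2, (f₂ v.2).2⟩
    · rintro ⟨ha, hb⟩
      refine ⟨(f₁.symm ⟨_, ha⟩, f₂.symm ⟨_, hb⟩), ?_⟩
      rw [hψ]
      ext (i | i) <;> simp [LinearMap.funLeft]
  rw [← e1, ← e2]
  have : Fintype (W₁ × W₂) := Fintype.ofFinite _
  refine isoZero_range_of_hammingNorm_eq φ ψ fun v => ?_
  have e3 : φ v = v.1.1 + v.2.1 := rfl
  rw [hψ, e3, hammingNorm_add_of_mul_eq_zero (hW _ v.1.2 _ v.2.2), ← hf₁, ← hf₂]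
  simp only [hammingNorm, Finset.card_filter, Fintype.sum_sum_type, Sum.elim_inl, Sum.elim_inr]
  rfl

section Rep

lemma hammingNorm_comp_fst [Fintype ι] (m : ℕ) (c : ι → ZMod 2) :
    hammingNorm (fun p : ι × Fin m => c p.1) = m * hammingNorm c := by
  simp only [hammingNorm, Finset.card_filter, Fintype.sum_prod_type, Finset.mul_sum]
  refine Finset.sum_congr rfl fun i _ => ?_
  by_cases h : c i = 0 <;> simp [h]

/-- A code is linearly equivalent to each of its repetitions. -/
noncomputable def repEquiv (m : ℕ) [NeZero m] (C : BinaryCode ι) : C ≃ₗ[ZMod 2] rep m C :=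
  Submodule.equivMapOfInjective _
    (LinearMap.funLeft_injective_of_surjective _ _ _ fun i => ⟨(i, 0), rfl⟩) C

lemma coe_repEquiv (m : ℕ) [NeZero m] (C : BinaryCode ι) (c : C) :
    (repEquiv m C c).1 = fun p => c.1 p.1 := rfl

lemma hammingNorm_repEquiv [Fintype ι] (m : ℕ) [NeZero m] (C : BinaryCode ι) (c : C) :
    hammingNorm (repEquiv m C c).1 = m * hammingNorm c.1 := by
  rw [coe_repEquiv, hammingNorm_comp_fst]

lemma finrank_rep (m : ℕ) (hm : m ≠ 0) (C : BinaryCode ι) :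
    Module.finrank (ZMod 2) (rep m C) = Module.finrank (ZMod 2) C :=
  have : NeZero m := ⟨hm⟩
  (repEquiv m C).finrank_eq.symm

lemma finrank_directSum [Finite ι] [Finite κ] (C : BinaryCode ι) (D : BinaryCode κ) :
    Module.finrank (ZMod 2) (directSum C D) =
      Module.finrank (ZMod 2) C + Module.finrank (ZMod 2) D := by
  rw [← Module.finrank_prod]
  refine (LinearEquiv.finrank_eq ?_)
  exact
    { toFun := fun x => (⟨_, x.2.1⟩, ⟨_, x.2.2⟩)
      invFun := fun x => ⟨Sum.elim x.1.1 x.2.1, x.1.2, x.2.2⟩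
      map_add' := fun _ _ => rfl
      map_smul' := fun _ _ => rfl
      left_inv := fun x => Subtype.ext (by ext (i | i) <;> rfl)
      right_inv := fun x => rfl }

lemma finrank_restrict_supp (C : BinaryCode ι) :
    Module.finrank (ZMod 2) (C.restrict C.supp) = Module.finrank (ZMod 2) C := by
  refine LinearEquiv.finrank_eq (LinearEquiv.symm (LinearEquiv.ofBijective
    ((LinearMap.funLeft (ZMod 2) (ZMod 2) (Subtype.val : C.supp → ι)).submoduleMap C)
    ⟨?_, LinearMap.submoduleMap_surjective _ _⟩))
  rw [← LinearMap.ker_eq_bot, LinearMap.ker_eq_bot']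
  intro c hc
  ext i
  by_contra hi
  exact hi (congrFun (congrArg Subtype.val hc) ⟨i, c.1, c.2, hi⟩)

lemma IsoZero.finrank_eq {C : BinaryCode ι} {D : BinaryCode κ} (h : IsoZero C D) :
    Module.finrank (ZMod 2) C = Module.finrank (ZMod 2) D := by
  obtain ⟨e, he⟩ := h
  rw [← finrank_restrict_supp C, ← finrank_restrict_supp D, ← he]
  exact (Submodule.equivMapOfInjective _
    (LinearMap.funLeft_injective_of_surjective _ _ _ e.surjective) _).finrank_eq

end Rep

/-! ### Simplex codes: dimension and weights. -/

section Simplex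

lemma rowSpan_eq_range [Fintype κ] (G : Matrix κ ι (ZMod 2)) :
    rowSpan G = LinearMap.range (Fintype.linearCombination (ZMod 2) fun r => G r) :=
  (Fintype.range_linearCombination _ _).symm

/-- The generic codeword of the simplex code. -/
def simWord (k : ℕ) : (Fin k → ZMod 2) →ₗ[ZMod 2] {v : Fin k → ZMod 2 // v ≠ 0} → ZMod 2 :=
  Fintype.linearCombination (ZMod 2) fun r v => v.1 r

lemma simWord_apply (k : ℕ) (l : Fin k → ZMod 2) (v) : simWord k l v = ∑ r, l r * v.1 r := by
  simp [simWord, Fintype.linearCombination_apply]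

lemma simWord_injective (k : ℕ) : Function.Injective (simWord k) := by
  rw [← LinearMap.ker_eq_bot, LinearMap.ker_eq_bot']
  intro l hl
  ext r
  have := congrFun hl ⟨Pi.single r 1, by simp⟩
  rw [simWord_apply] at this
  simpa [Pi.single_apply] using this

lemma finrank_sim (k : ℕ) : Module.finrank (ZMod 2) (Sim k) = k := by
  rw [Sim, rowSpan_eq_range]
  refine (LinearMap.finrank_range_of_inj (simWord_injective k)).trans ?_
  simp

lemma hammingNorm_sim_one (c) (hc : c ∈ Sim 1) (h : c ≠ 0) : hammingNorm c = 1 := by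
  rw [Sim, rowSpan_eq_range] at hc
  obtain ⟨l, rfl⟩ := hc
  have key : ∀ l : Fin 1 → ZMod 2, l ≠ 0 →
      hammingNorm (fun v : {v : Fin 1 → ZMod 2 // v ≠ 0} => ∑ r, l r * v.1 r) = 1 := by decide
  have e : simWord 1 l = fun v => ∑ r, l r * v.1 r := funext fun v => simWord_apply 1 l v
  change hammingNorm (simWord 1 l) = 1
  rw [e]
  refine key l ?_
  rintro rfl
  exact h (map_zero _)

lemma hammingNorm_sim_two (c) (hc : c ∈ Sim 2) (h : c ≠ 0) : hammingNorm c = 2 := by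
  rw [Sim, rowSpan_eq_range] at hc
  obtain ⟨l, rfl⟩ := hc
  have key : ∀ l : Fin 2 → ZMod 2, l ≠ 0 →
      hammingNorm (fun v : {v : Fin 2 → ZMod 2 // v ≠ 0} => ∑ r, l r * v.1 r) = 2 := by decide
  have e : simWord 2 l = fun v => ∑ r, l r * v.1 r := funext fun v => simWord_apply 2 l v
  change hammingNorm (simWord 2 l) = 2
  rw [e]
  refine key l ?_
  rintro rfl
  exact h (map_zero _)

end Simplex

/-! ### First order Reed-Muller codes: dimension and weights. -/

section ReedMuller

/-- The generic codeword of the first order Reed-Muller code: an affine function. -/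
def rmWord (n : ℕ) : (Fin n ⊕ Unit → ZMod 2) →ₗ[ZMod 2] (Fin n → ZMod 2) → ZMod 2 :=
  Fintype.linearCombination (ZMod 2) fun r v => Sum.elim (fun s => v s) (fun _ => 1) r

lemma rmWord_apply (n : ℕ) (l : Fin n ⊕ Unit → ZMod 2) (v) :
    rmWord n l v = ∑ r, l (Sum.inl r) * v r + l (Sum.inr ()) := by
  simp [rmWord, Fintype.linearCombination_apply]

lemma rmWord_injective (n : ℕ) : Function.Injective (rmWord n) := by
  rw [← LinearMap.ker_eq_bot, LinearMap.ker_eq_bot']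
  intro l hl
  have h0 : l (Sum.inr ()) = 0 := by
    have := congrFun hl 0
    rw [rmWord_apply] at this
    simpa using this
  ext (r | r)
  · have := congrFun hl (Pi.single r 1)
    rw [rmWord_apply] at this
    simpa [Pi.single_apply, h0] using this
  · exact h0

lemma finrank_rm (k : ℕ) (hk : 1 ≤ k) : Module.finrank (ZMod 2) (RM k) = k := by
  rw [RM, rowSpan_eq_range]
  refine (LinearMap.finrank_range_of_inj (rmWord_injective (k - 1))).trans ?_
  simp
  omega

lemma one_mem_rm (k : ℕ) : (1 : (Fin (k - 1) → ZMod 2) → ZMod 2) ∈ RM k :=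
  Submodule.subset_span ⟨Sum.inr (), rfl⟩

/-- A nonconstant affine function depends on some coordinate r; shifting along r complements its
values, so it is balanced. -/
lemma hammingNorm_rm (k : ℕ) (hk : 2 ≤ k) (c) (hc : c ∈ RM k) (h0 : c ≠ 0) (h1 : c ≠ 1) :
    hammingNorm c = 2 ^ (k - 2) := by
  rw [RM, rowSpan_eq_range] at hc
  obtain ⟨l, hl⟩ := hc
  change rmWord (k - 1) l = c at hl
  have hr : ∃ r, l (Sum.inl r) ≠ 0 := by
    by_contra! hr
    have e : c = fun _ => l (Sum.inr ()) := by
      rw [← hl]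
      funext v
      simp [rmWord_apply, hr]
    have : ∀ a : ZMod 2, a = 0 ∨ a = 1 := by decide
    rcases this (l (Sum.inr ())) with h | h
    · exact h0 (by rw [e, h]; rfl)
    · exact h1 (by rw [e, h]; rfl)
  obtain ⟨r, hr⟩ := hr
  have hr1 : l (Sum.inl r) = 1 := by
    revert hr
    generalize l (Sum.inl r) = a
    revert a
    decide
  have hflip : ∀ v, c (v + Pi.single r 1) = c v + 1 := by
    intro v
    simp only [← hl, rmWord_apply, Pi.add_apply, mul_add, Finset.sum_add_distrib]
    simp only [Pi.single_apply, mul_ite, mul_one, mul_zero, Finset.sum_ite_eq', Finset.mem_univ,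
      if_true, hr1]
    ring
  have hs : ∑ v, sgn (c v) = 0 := by
    have e : ∑ v, sgn (c (v + Pi.single r 1)) = ∑ v, sgn (c v) :=
      Fintype.sum_equiv (Equiv.addRight (Pi.single r 1)) _ _ fun v => rfl
    have e1 : sgn 1 = -1 := by decide
    simp only [hflip, sgn_add, e1, ← Finset.sum_mul] at e
    linarith
  rw [sum_sgn] at hs
  have e : Fintype.card (Fin (k - 1) → ZMod 2) = 2 * 2 ^ (k - 2) := by
    rw [Fintype.card_fun, Fintype.card_fin, ZMod.card, ← pow_succ']
    congr 1
    omega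
  rw [e] at hs
  push_cast at hs
  have : (hammingNorm c : ℤ) = ((2 ^ (k - 2) : ℕ) : ℤ) := by
    push_cast
    linarith
  exact_mod_cast this

lemma hammingNorm_one_rm (k : ℕ) (hk : 2 ≤ k) :
    hammingNorm (1 : (Fin (k - 1) → ZMod 2) → ZMod 2) = 2 * 2 ^ (k - 2) := by
  have e : Fintype.card (Fin (k - 1) → ZMod 2) = 2 * 2 ^ (k - 2) := by
    rw [Fintype.card_fun, Fintype.card_fin, ZMod.card, ← pow_succ']
    congr 1
    omega
  rw [← e]
  simp [hammingNorm]

end ReedMuller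

/-! ### Parity check codes. -/

section ParityCheck

lemma mem_pc (k : ℕ) (c : Fin (k + 1) → ZMod 2) : c ∈ PC k ↔ ∑ i, c i = 0 := Iff.rfl

lemma finrank_pc (k : ℕ) : Module.finrank (ZMod 2) (PC k) = k := by
  have e : (Fin k → ZMod 2) ≃ₗ[ZMod 2] PC k :=
    { toFun := fun c => ⟨Fin.cons (∑ i, c i) c, by
        rw [mem_pc, Fin.sum_univ_succ]
        simp [CharTwo.add_self_eq_zero]⟩
      invFun := fun c i => c.1 i.succ
      map_add' := fun c d => Subtype.ext (by
        ext i
        refine Fin.cases ?_ (fun j => ?_) i <;> simp [Finset.sum_add_distrib])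
      map_smul' := fun t c => Subtype.ext (by
        ext i
        refine Fin.cases ?_ (fun j => ?_) i <;> simp [Finset.mul_sum])
      left_inv := fun c => by simp
      right_inv := fun c => Subtype.ext (by
        have hc := c.2
        rw [mem_pc, Fin.sum_univ_succ] at hc
        ext i
        refine Fin.cases ?_ (fun j => ?_) i
        · simpa using (CharTwo.add_eq_zero.1 hc).symm
        · simp) }
  rw [← e.finrank_eq]
  simp

end ParityCheck

/-! ### Codes built from words of one weight. -/

section Subcodes

/-- A set of words that contains zero and is closed under addition is a code. -/
def ofAddClosed (T : Set (ι → ZMod 2)) (h0 : 0 ∈ T) (hadd : ∀ x ∈ T, ∀ y ∈ T, x + y ∈ T) :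
    BinaryCode ι where
  carrier := T
  zero_mem' := h0
  add_mem' := fun {x y} hx hy => hadd x hx y hy
  smul_mem' := fun t x hx => by
    have : ∀ t : ZMod 2, t = 0 ∨ t = 1 := by decide
    rcases this t with rfl | rfl
    · simpa using h0
    · simpa using hx

lemma ncard_eq_two_pow [Finite ι] (W : BinaryCode ι) :
    (W : Set (ι → ZMod 2)).ncard = 2 ^ Module.finrank (ZMod 2) W := by
  have := Module.natCard_eq_pow_finrank (K := ZMod 2) (V := W)
  rw [Nat.card_zmod] at this
  rw [← this]
  rfl

/-- The word `x` belongs to the code and has weight `w`. -/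
def HasWeight [Fintype ι] (C : BinaryCode ι) (w : ℕ) (x : ι → ZMod 2) : Prop :=
  x ∈ C ∧ hammingNorm x = w

variable [Fintype ι] {C : BinaryCode ι} {D : ℕ}

lemma HasWeight.ne_zero {x : ι → ZMod 2} (hD : 0 < D) (hx : C.HasWeight D x) : x ≠ 0 := by
  rintro rfl
  have := hx.2
  simp at this
  omega

/-- The weight of x + y is a nonzero multiple of D and at most 2D, so it is D or 2D. -/
lemma HasWeight.mul_eq_zero_or (hD : 0 < D) (hdiv : C.Divisible D) {x y : ι → ZMod 2}
    (hx : C.HasWeight D x) (hy : C.HasWeight D y) (hxy : x ≠ y) :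
    x * y = 0 ∨ (2 * hammingNorm (x * y) = D ∧ C.HasWeight D (x + y)) := by
  have hmem := C.add_mem hx.1 hy.1
  have h := hammingNorm_add_add x y
  rw [hx.2, hy.2] at h
  obtain ⟨t, ht⟩ := hdiv _ hmem
  have h0 : hammingNorm (x + y) ≠ 0 := fun h0 =>
    hxy (add_eq_zero_iff_word.1 (hammingNorm_eq_zero.1 h0))
  have ht0 : t ≠ 0 := by
    rintro rfl
    simp at ht
    exact hxy (add_eq_zero_iff_word.1 ht)
  have ht2 : t ≤ 2 := by
    by_contra hc
    have : D * 3 ≤ D * t := Nat.mul_le_mul_left _ (by omega)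
    omega
  obtain rfl | rfl : t = 1 ∨ t = 2 := by omega
  · exact Or.inr ⟨by omega, hmem, by omega⟩
  · exact Or.inl (hammingNorm_eq_zero.1 (by omega))

lemma exists_code_insert_zero {T : Set (ι → ZMod 2)} (h0 : 0 ∉ T)
    (hT : ∀ x ∈ T, ∀ y ∈ T, x ≠ y → x + y ∈ T) :
    ∃ W : BinaryCode ι, (∀ x, x ∈ W ↔ x = 0 ∨ x ∈ T) ∧
      T.ncard + 1 = 2 ^ Module.finrank (ZMod 2) W := by
  refine ⟨ofAddClosed (insert 0 T) (by simp) ?_, fun x => Iff.rfl, ?_⟩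
  · rintro x (rfl | hx) y (rfl | hy)
    · simp
    · simp [hy]
    · simp [hx]
    · by_cases h : x = y
      · left
        exact add_eq_zero_iff_word.2 h
      · exact Or.inr (hT x hx y hy h)
  · rw [← ncard_eq_two_pow, ← Set.ncard_insert_of_notMem h0 (Set.toFinite _)]
    rfl

end Subcodes

/-! ### Counting the words of weight D. -/

section Counting

/-- Powers of two in a form that lets `omega` argue modulo 8. -/
lemma two_pow_cases (j : ℕ) : (j = 0 ∧ 2 ^ j = 1) ∨ (j = 1 ∧ 2 ^ j = 2) ∨ (j = 2 ∧ 2 ^ j = 4) ∨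
    (3 ≤ j ∧ ∃ t, 0 < t ∧ 2 ^ j = 8 * t) := by
  rcases Nat.lt_or_ge j 3 with h | h
  · interval_cases j <;> simp
  · refine Or.inr (Or.inr (Or.inr ⟨h, 2 ^ (j - 3), by positivity, ?_⟩))
    rw [show (8 : ℕ) = 2 ^ 3 by norm_num, ← pow_add]
    congr 1
    omega

lemma eq_of_two_pow_add_two_pow {k l j : ℕ} (h : 2 ^ k + 2 ^ l = 2 ^ j) : k = l := by
  wlog hkl : k ≤ l generalizing k l
  · exact (this (by rw [add_comm]; exact h) (by omega)).symm
  by_contra hne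
  have hj : l < j := by
    rw [← Nat.pow_lt_pow_iff_right (a := 2) (by norm_num)]
    have : 0 < 2 ^ k := by positivity
    omega
  have h1 : 2 ^ (k + 1) ∣ 2 ^ j := Nat.pow_dvd_pow 2 (by omega)
  have h2 : 2 ^ (k + 1) ∣ 2 ^ l := Nat.pow_dvd_pow 2 (by omega)
  rw [← h] at h1
  have h3 := Nat.pow_dvd_pow_iff_le_right (x := 2) (by norm_num) |>.1
    ((Nat.dvd_add_left h2).1 h1)
  omega

/-- In the second moment, the zero word and the all-one word contribute 16D² each, words of weight D
or 3D contribute 4D², and those of weight 2D nothing. Complementation matches weight 3D with weight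
D. -/
lemma ncard_hasWeight_add_four [Fintype ι] {D : ℕ} (hD : 0 < D) (hι : Fintype.card ι = 4 * D)
    {C : BinaryCode ι} (hproj : C.Projective) (hdiv : C.Divisible D) (hone : 1 ∈ C) :
    ({x | C.HasWeight D x}.ncard + 4) * (2 * D) = 2 ^ Module.finrank (ZMod 2) C := by
  classical
  have : Fintype C := Fintype.ofFinite _
  let o : C := ⟨1, hone⟩
  have hcompl : ∀ x : ι → ZMod 2, hammingNorm (x + 1) + hammingNorm x = 4 * D := by
    intro x
    have h1 := hammingNorm_add_add x 1
    have h2 : hammingNorm (1 : ι → ZMod 2) = 4 * D := by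
      rw [← hι]
      simp [hammingNorm]
    rw [mul_one, h2] at h1
    omega
  have hterm : ∀ c : C, ((Fintype.card ι : ℤ) - 2 * hammingNorm c.1) ^ 2 =
      4 * (D : ℤ) ^ 2 * (4 * (if c = 0 then 1 else 0) + 4 * (if c = o then 1 else 0) +
        (if hammingNorm c.1 = D then 1 else 0) +
        (if hammingNorm (c + o).1 = D then 1 else 0)) := by
    intro c
    have hle := hcompl c.1
    have hc0 : c = 0 ↔ hammingNorm c.1 = 0 := by
      rw [hammingNorm_eq_zero]
      exact Subtype.ext_iff
    have hc1 : c = o ↔ hammingNorm c.1 = 4 * D := by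
      rw [Subtype.ext_iff, ← add_eq_zero_iff_word, ← hammingNorm_eq_zero]
      change hammingNorm (c.1 + 1) = 0 ↔ _
      omega
    have hc2 : hammingNorm (c + o).1 = D ↔ hammingNorm c.1 = 3 * D := by
      change hammingNorm (c.1 + 1) = D ↔ _
      omega
    simp only [hc0, hc1, hc2]
    obtain ⟨t, ht⟩ := hdiv c.1 c.2
    have ht4 : t ≤ 4 := by
      by_contra hc
      have : D * 5 ≤ D * t := Nat.mul_le_mul_left _ (by omega)
      omega
    rw [ht, hι]
    have e0 : D * t = 0 ↔ t = 0 := by simp; omega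
    have e1 : D * t = D ↔ t = 1 := by
      constructor
      · exact fun h => Nat.eq_of_mul_eq_mul_left hD (by omega)
      · rintro rfl
        omega
    have e3 : D * t = 3 * D ↔ t = 3 := by
      constructor
      · exact fun h => Nat.eq_of_mul_eq_mul_left hD (by omega)
      · rintro rfl
        omega
    have e4 : D * t = 4 * D ↔ t = 4 := by
      constructor
      · exact fun h => Nat.eq_of_mul_eq_mul_left hD (by omega)
      · rintro rfl
        omega
    simp only [e0, e1, e3, e4]
    push_cast
    clear ht e0 e1 e3 e4 hc0 hc1 hc2 hle
    interval_cases t <;> simp <;> ring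
  have hshift : ∑ c : C, (if hammingNorm (c + o).1 = D then (1 : ℤ) else 0) =
      ∑ c : C, (if hammingNorm c.1 = D then (1 : ℤ) else 0) :=
    Fintype.sum_equiv (Equiv.addRight o) _ _ fun v => rfl
  have hcard : ∑ c : C, (if hammingNorm c.1 = D then (1 : ℤ) else 0) =
      {x | C.HasWeight D x}.ncard := by
    rw [Finset.sum_boole, ← Set.ncard_coe_finset, Finset.coe_filter,
      ← Set.ncard_image_of_injective _ Subtype.val_injective]
    congr 2
    ext x
    simp [HasWeight, and_comm]
  have hC : Fintype.card C = 2 ^ Module.finrank (ZMod 2) C := by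
    rw [← ncard_eq_two_pow, ← Nat.card_eq_fintype_card]
    rfl
  have h := hproj.sum_sq_eq
  rw [Finset.sum_congr rfl fun c _ => hterm c, hC, hι] at h
  simp only [← Finset.mul_sum, Finset.sum_add_distrib, hshift, hcard, Finset.sum_ite_eq',
    Finset.mem_univ, if_true] at h
  have hne : 4 * (D : ℤ) ≠ 0 := by positivity
  have h' : 4 * (D : ℤ) * ((({x | C.HasWeight D x}.ncard + 4) * (2 * D) : ℕ) : ℤ) =
      4 * (D : ℤ) * ((2 ^ Module.finrank (ZMod 2) C : ℕ) : ℤ) := by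
    push_cast at h ⊢
    linarith
  exact_mod_cast mul_left_cancel₀ hne h'

end Counting

/-! ### Five or more blocks: the parity check case. -/

section Blocks

variable [Fintype ι] {C : BinaryCode ι} {D : ℕ}

/-- Disjoint words of weight `D / 2` all of whose pairwise sums are codewords. -/
def Blocks (C : BinaryCode ι) (D : ℕ) (B : Finset (ι → ZMod 2)) : Prop :=
  (∀ b ∈ B, 2 * hammingNorm b = D) ∧
    (B : Set (ι → ZMod 2)).Pairwise fun b b' => b * b' = 0 ∧ b + b' ∈ C

variable {B : Finset (ι → ZMod 2)}

lemma Blocks.ne_zero (hD : 0 < D) (hB : Blocks C D B) {b} (hb : b ∈ B) : b ≠ 0 := by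
  rintro rfl
  have := hB.1 _ hb
  simp at this
  omega

lemma Blocks.hasWeight_add (hB : Blocks C D B) {b b'} (hb : b ∈ B) (hb' : b' ∈ B) (h : b ≠ b') :
    C.HasWeight D (b + b') := by
  have h1 := hB.2 hb hb' h
  refine ⟨h1.2, ?_⟩
  rw [hammingNorm_add_of_mul_eq_zero h1.1]
  have := hB.1 b hb
  have := hB.1 b' hb'
  omega

lemma Blocks.insert_word [DecidableEq ι] (hB : Blocks C D B) {c : ι → ZMod 2}
    (hc : 2 * hammingNorm c = D) (h : ∀ b ∈ B, c * b = 0 ∧ c + b ∈ C) :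
    Blocks C D (insert c B) := by
  have : Std.Symm fun b b' : ι → ZMod 2 => b * b' = 0 ∧ b + b' ∈ C :=
    ⟨fun x y hxy => by rwa [mul_comm, add_comm]⟩
  refine ⟨?_, ?_⟩
  · intro b hb
    rcases Finset.mem_insert.1 hb with rfl | hb
    · exact hc
    · exact hB.1 b hb
  · rw [Finset.coe_insert, Set.pairwise_insert_of_symm]
    exact ⟨hB.2, fun b hb _ => h b hb⟩

/-- If u is no pair sum, it meets each pair of blocks in 0 or D/2 positions altogether. A u meeting
two blocks would meet every block in D/4 positions, too much for five blocks; a u meeting only b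
contains b, and u + b is a new block. -/
lemma Blocks.trichotomy [DecidableEq ι] (hD : 0 < D) (hdiv : C.Divisible D) (hB : Blocks C D B)
    (h5 : 5 ≤ B.card) {u : ι → ZMod 2} (hu : C.HasWeight D u) :
    (∀ b ∈ B, u * b = 0) ∨ (∃ b ∈ B, ∃ b' ∈ B, b ≠ b' ∧ u = b + b') ∨
      ∃ c ∉ B, Blocks C D (insert c B) := by
  by_cases h1 : ∀ b ∈ B, u * b = 0
  · exact Or.inl h1
  by_cases h2 : ∃ b ∈ B, ∃ b' ∈ B, b ≠ b' ∧ u = b + b'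
  · exact Or.inr (Or.inl h2)
  refine Or.inr (Or.inr ?_)
  push Not at h1 h2
  have hdis : ∀ b ∈ B, ∀ b' ∈ B, b ≠ b' → (u * b) * (u * b') = 0 := by
    intro b hb b' hb' hne
    rw [mul_mul_mul_comm, (hB.2 hb hb' hne).1, mul_zero]
  have key : ∀ b ∈ B, ∀ b' ∈ B, b ≠ b' →
      hammingNorm (u * b) + hammingNorm (u * b') = 0 ∨
        2 * (hammingNorm (u * b) + hammingNorm (u * b')) = D := by
    intro b hb b' hb' hne
    rw [← hammingNorm_add_of_mul_eq_zero (hdis b hb b' hb' hne), ← mul_add]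
    rcases hu.mul_eq_zero_or hD hdiv (hB.hasWeight_add hb hb' hne) (h2 b hb b' hb' hne) with h | h
    · exact Or.inl (by simp [h])
    · exact Or.inr h.1
  obtain ⟨b, hb, hub⟩ := h1
  have hnb : hammingNorm (u * b) ≠ 0 := fun h => hub (hammingNorm_eq_zero.1 h)
  have key2 : ∀ b' ∈ B, b' ≠ b → 2 * (hammingNorm (u * b) + hammingNorm (u * b')) = D := by
    intro b' hb' hne
    rcases key b hb b' hb' hne.symm with h | h
    · omega
    · exact h
  by_cases h3 : ∃ b' ∈ B, b' ≠ b ∧ u * b' ≠ 0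
  · exfalso
    obtain ⟨b', hb', hne, hub'⟩ := h3
    have hnb' : hammingNorm (u * b') ≠ 0 := fun h => hub' (hammingNorm_eq_zero.1 h)
    have hcard : 0 < ((B.erase b).erase b').card := by
      rw [Finset.card_erase_of_mem (by simp [hb', hne]), Finset.card_erase_of_mem hb]
      omega
    obtain ⟨b'', hb''⟩ := Finset.card_pos.1 hcard
    simp only [Finset.mem_erase] at hb''
    obtain ⟨hne', hne'', hb''⟩ := hb''
    have e1 := key2 b' hb' hne
    have e2 := key2 b'' hb'' hne''
    have e3 : 4 * hammingNorm (u * b) = D := by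
      rcases key b' hb' b'' hb'' hne'.symm with h | h <;> omega
    have hall : ∀ x ∈ B, hammingNorm (u * x) = hammingNorm (u * b) := by
      intro x hx
      by_cases hxb : x = b
      · rw [hxb]
      · have := key2 x hx hxb
        omega
    have hsum := hammingNorm_sum_of_pairwise B (fun x => u * x)
      (fun x hx y hy hxy => hdis x hx y hy hxy)
    rw [Finset.sum_congr rfl hall, Finset.sum_const, smul_eq_mul, ← Finset.mul_sum] at hsum
    have hle := hammingNorm_mul_le u (∑ i ∈ B, i)
    rw [hsum, hu.2] at hle
    have := Nat.mul_le_mul_right (hammingNorm (u * b)) h5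
    omega
  · push Not at h3
    have hcard : 0 < (B.erase b).card := by
      rw [Finset.card_erase_of_mem hb]
      omega
    obtain ⟨b', hb'⟩ := Finset.card_pos.1 hcard
    simp only [Finset.mem_erase] at hb'
    have e1 := key2 b' hb'.2 hb'.1
    rw [h3 b' hb'.2 hb'.1, hammingNorm_zero, add_zero] at e1
    have e2 := hB.1 b hb
    have hbu : b * u = b := mul_eq_of_hammingNorm_eq (by rw [mul_comm b u]; omega)
    have hub1 : u * b = b := by rw [mul_comm, hbu]
    have hc2 : 2 * hammingNorm (u + b) = D := by
      have := hammingNorm_add_add u b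
      rw [hub1, hu.2] at this
      omega
    have hcb : (u + b) * b = 0 := by
      rw [add_mul, hub1, mul_self_word]
      exact add_eq_zero_iff_word.2 rfl
    refine ⟨u + b, ?_, hB.insert_word hc2 ?_⟩
    · intro hmem
      have hne : u + b ≠ b := by
        intro h
        rw [h, mul_self_word] at hcb
        exact hB.ne_zero hD hb hcb
      refine h2 _ hmem b hb hne ?_
      rw [add_assoc, add_eq_zero_iff_word.2 rfl, add_zero]
    · intro x hx
      by_cases hxb : x = b
      · subst hxb
        refine ⟨hcb, ?_⟩
        rw [add_assoc, add_eq_zero_iff_word.2 rfl, add_zero]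
        exact hu.1
      · refine ⟨?_, ?_⟩
        · rw [add_mul, h3 x hx hxb, (hB.2 hb hx (Ne.symm hxb)).1, add_zero]
        · rw [add_assoc]
          exact C.add_mem hu.1 (hB.2 hb hx (Ne.symm hxb)).2

lemma Blocks.exists_maximal [DecidableEq ι] (hB : Blocks C D B) (h5 : 5 ≤ B.card) :
    ∃ B', Blocks C D B' ∧ 5 ≤ B'.card ∧ ∀ c ∉ B', ¬ Blocks C D (insert c B') := by
  classical
  obtain ⟨B', hB', hmax⟩ := Finset.exists_max_image
    (Finset.univ.filter fun B' => Blocks C D B' ∧ 5 ≤ B'.card) Finset.card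
    ⟨B, by simp [hB, h5]⟩
  simp only [Finset.mem_filter, Finset.mem_univ, true_and] at hB' hmax
  refine ⟨B', hB'.1, hB'.2, fun c hc hins => ?_⟩
  have h := hmax _ ⟨hins, by rw [Finset.card_insert_of_notMem hc]; omega⟩
  rw [Finset.card_insert_of_notMem hc] at h
  omega

/-- Disjointness lets a sum of blocks recover its summands: they are the blocks it meets. -/
lemma Blocks.ncard_pairs [DecidableEq ι] (hD : 0 < D) (hB : Blocks C D B) :
    {u | ∃ b ∈ B, ∃ b' ∈ B, b ≠ b' ∧ u = b + b'}.ncard = B.card.choose 2 := by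
  classical
  have e : {u | ∃ b ∈ B, ∃ b' ∈ B, b ≠ b' ∧ u = b + b'} =
      ((B.powersetCard 2).image fun s => ∑ b ∈ s, b : Finset (ι → ZMod 2)) := by
    ext u
    simp only [Set.mem_ofPred_eq, Finset.coe_image, Set.mem_image, Finset.mem_coe,
      Finset.mem_powersetCard, Finset.card_eq_two]
    constructor
    · rintro ⟨b, hb, b', hb', hne, rfl⟩
      refine ⟨{b, b'}, ⟨?_, b, b', hne, rfl⟩, Finset.sum_pair hne⟩
      simp [Finset.insert_subset_iff, hb, hb']
    · rintro ⟨s, ⟨hs, b, b', hne, rfl⟩, rfl⟩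
      exact ⟨b, hs (by simp), b', hs (by simp), hne, Finset.sum_pair hne⟩
  rw [e, Set.ncard_coe_finset, Finset.card_image_of_injOn, Finset.card_powersetCard]
  have hmul : ∀ s ⊆ B, ∀ b ∈ B, (b ∈ s ↔ b * ∑ x ∈ s, x ≠ 0) := by
    intro s hs b hb
    rw [Finset.mul_sum]
    constructor
    · intro hbs
      rw [Finset.sum_eq_single_of_mem b hbs fun x hx hne => (hB.2 hb (hs hx) hne.symm).1,
        mul_self_word]
      exact hB.ne_zero hD hb
    · intro hne
      by_contra hbs
      refine hne (Finset.sum_eq_zero fun x hx => (hB.2 hb (hs hx) ?_).1)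
      rintro rfl
      exact hbs hx
  intro s hs t ht hst
  replace hs := (Finset.mem_powersetCard.1 hs).1
  replace ht := (Finset.mem_powersetCard.1 ht).1
  ext b
  constructor
  · intro hb
    rw [hmul t ht b (hs hb)]
    simp only at hst
    rw [← hst]
    exact (hmul s hs b (hs hb)).1 hb
  · intro hb
    rw [hmul s hs b (ht hb)]
    simp only at hst
    rw [hst]
    exact (hmul t ht b (ht hb)).1 hb

/-- For a maximal family, the words that are not pair sums avoid all blocks. No two of these are
disjoint, for lack of room, so with 0 they form a code; the count then fixes the number of blocks.
-/
lemma Blocks.exists_eight [DecidableEq ι] (hD : 0 < D) (hι : Fintype.card ι = 4 * D)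
    (hdiv : C.Divisible D) (hB : Blocks C D B) (h5 : 5 ≤ B.card) {j : ℕ}
    (hj : {x | C.HasWeight D x}.ncard + 4 = 2 ^ j) :
    ∃ B', Blocks C D B' ∧ B'.card = 8 ∧ j = 5 ∧
      ∀ u, C.HasWeight D u → ∃ b ∈ B', ∃ b' ∈ B', b ≠ b' ∧ u = b + b' := by
  obtain ⟨B, hB, h5, hmax⟩ := hB.exists_maximal h5
  have hcase : ∀ u, C.HasWeight D u → (∀ b ∈ B, u * b = 0) ∨
      ∃ b ∈ B, ∃ b' ∈ B, b ≠ b' ∧ u = b + b' := by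
    intro u hu
    rcases hB.trichotomy hD hdiv h5 hu with h | h | ⟨c, hc, h⟩
    · exact Or.inl h
    · exact Or.inr h
    · exact absurd h (hmax c hc)
  set R : Set (ι → ZMod 2) := {u | C.HasWeight D u ∧ ∀ b ∈ B, u * b = 0}
  set P : Set (ι → ZMod 2) := {u | ∃ b ∈ B, ∃ b' ∈ B, b ≠ b' ∧ u = b + b'}
  have hBsum : 2 * hammingNorm (∑ b ∈ B, b) = B.card * D := by
    rw [hammingNorm_sum_of_pairwise B (fun b => b) fun b hb b' hb' hne => (hB.2 hb hb' hne).1,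
      Finset.mul_sum, Finset.sum_congr rfl hB.1, Finset.sum_const, smul_eq_mul]
  have hRB : ∀ u ∈ R, (∑ b ∈ B, b) * u = 0 := by
    intro u hu
    rw [mul_comm, Finset.mul_sum]
    exact Finset.sum_eq_zero hu.2
  have hRpair : ∀ x ∈ R, ∀ y ∈ R, x ≠ y → x + y ∈ R := by
    intro x hx y hy hxy
    rcases hx.1.mul_eq_zero_or hD hdiv hy.1 hxy with h | h
    · exfalso
      have h1 : hammingNorm (∑ b ∈ B, b + (x + y)) =
          hammingNorm (∑ b ∈ B, b) + (hammingNorm x + hammingNorm y) := by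
        rw [hammingNorm_add_of_mul_eq_zero, hammingNorm_add_of_mul_eq_zero h]
        rw [mul_add, hRB x hx, hRB y hy, add_zero]
      have h2 : hammingNorm (∑ b ∈ B, b + (x + y)) ≤ _ := hammingNorm_le_card_fintype
      rw [h1, hx.1.2, hy.1.2, hι] at h2
      have := Nat.mul_le_mul_right D h5
      omega
    · refine ⟨h.2, fun b hb => ?_⟩
      rw [add_mul, hx.2 b hb, hy.2 b hb, add_zero]
  have h0R : (0 : ι → ZMod 2) ∉ R := fun h => h.1.ne_zero hD rfl
  obtain ⟨W, -, hW⟩ := exists_code_insert_zero h0R hRpair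
  have h8 : B.card ≤ 8 := by
    have h2 : hammingNorm (∑ b ∈ B, b) ≤ _ := hammingNorm_le_card_fintype
    by_contra hc
    have := Nat.mul_le_mul_right D (show 9 ≤ B.card by omega)
    omega
  have h7 : 7 ≤ B.card → R = ∅ := by
    intro h7
    rw [Set.eq_empty_iff_forall_notMem]
    intro u hu
    have h1 := hammingNorm_add_of_mul_eq_zero (hRB u hu)
    have h2 : hammingNorm (∑ b ∈ B, b + u) ≤ _ := hammingNorm_le_card_fintype
    rw [h1, hu.1.2, hι] at h2
    have := Nat.mul_le_mul_right D h7
    omega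
  have hM : {x | C.HasWeight D x} = P ∪ R := by
    ext u
    constructor
    · intro hu
      rcases hcase u hu with h | h
      · exact Or.inr ⟨hu, h⟩
      · exact Or.inl h
    · rintro (⟨b, hb, b', hb', hne, rfl⟩ | hu)
      · exact hB.hasWeight_add hb hb' hne
      · exact hu.1
  have hPR : Disjoint P R := by
    rw [Set.disjoint_left]
    rintro _ ⟨b, hb, b', hb', hne, rfl⟩ hu
    have := hu.2 b hb
    rw [add_mul, mul_self_word, mul_comm b' b, (hB.2 hb hb' hne).1, add_zero] at this
    exact hB.ne_zero hD hb this
  rw [hM, Set.ncard_union_eq hPR (Set.toFinite _) (Set.toFinite _), hB.ncard_pairs hD] at hj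
  -- With r = dim W, five blocks give 13 + 2^r, six give 18 + 2^r and seven give 25, none a power of
  -- two; eight give 28 + 4 = 32.
  have hcard : B.card = 8 ∧ j = 5 := by
    have c5 : Nat.choose 5 2 = 10 := by decide
    have c6 : Nat.choose 6 2 = 15 := by decide
    have c7 : Nat.choose 7 2 = 21 := by decide
    have c8 : Nat.choose 8 2 = 28 := by decide
    have hl := two_pow_cases (Module.finrank (ZMod 2) W)
    have hj' := two_pow_cases j
    obtain h | h | h | h : B.card = 5 ∨ B.card = 6 ∨ B.card = 7 ∨ B.card = 8 := by omega
    · rw [h, c5] at hj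
      exfalso
      omega
    · rw [h, c6] at hj
      exfalso
      omega
    · rw [h, c7, h7 h.ge, Set.ncard_empty] at hj
      exfalso
      omega
    · rw [h, c8, h7 (by omega), Set.ncard_empty] at hj
      refine ⟨h, Nat.pow_right_injective le_rfl (a₁ := j) (a₂ := 5) ?_⟩
      simp only
      omega
  refine ⟨B, hB, hcard.1, hcard.2, fun u hu => ?_⟩
  rcases hcase u hu with h | h
  · exfalso
    have : u ∈ R := ⟨hu, h⟩
    rw [h7 (by omega)] at this
    exact this
  · exact h

/-- Sending the unit vectors of 𝔽₂⁸ to the blocks multiplies weights by D/2 and maps the even weight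
words onto the span of the pair sums. -/
lemma Blocks.isoZero_pc [DecidableEq ι] (hB : Blocks C D B) (h8 : B.card = 8)
    (hM : ∀ u, C.HasWeight D u → ∃ b ∈ B, ∃ b' ∈ B, b ≠ b' ∧ u = b + b') :
    IsoZero (C.weightSubcode D) (rep (D / 2) (PC 7)) := by
  classical
  let e : Fin 8 ≃ B := (finCongr h8.symm).trans B.equivFin.symm
  let f : Fin 8 → ι → ZMod 2 := fun i => (e i).1
  have hfB : ∀ i, f i ∈ B := fun i => (e i).2
  have hfinj : Function.Injective f := fun i j h => e.injective (Subtype.ext h)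
  have hfsurj : ∀ b ∈ B, ∃ i, f i = b := fun b hb =>
    ⟨e.symm ⟨b, hb⟩, by simp [f]⟩
  let Φ : (Fin 8 → ZMod 2) →ₗ[ZMod 2] ι → ZMod 2 := Fintype.linearCombination (ZMod 2) f
  let φ : PC 7 →ₗ[ZMod 2] ι → ZMod 2 := Φ ∘ₗ (PC 7).subtype
  let ψ : PC 7 →ₗ[ZMod 2] Fin 8 × Fin (D / 2) → ZMod 2 :=
    LinearMap.funLeft (ZMod 2) (ZMod 2) Prod.fst ∘ₗ (PC 7).subtype
  have hψ : LinearMap.range ψ = rep (D / 2) (PC 7) := by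
    rw [LinearMap.range_comp, Submodule.range_subtype]
    rfl
  have hΦ : ∀ c, Φ c = ∑ i, c i • f i := fun c => Fintype.linearCombination_apply _ _ _
  have hsingle : ∀ i, Φ (Pi.single i 1) = f i := by
    intro i
    simp [Φ, Fintype.linearCombination_apply_single]
  have hφ : LinearMap.range φ = C.weightSubcode D := by
    refine le_antisymm ?_ (Submodule.span_le.2 ?_)
    · rintro _ ⟨c, rfl⟩
      have hc : c.1 0 = ∑ i : Fin 7, c.1 i.succ := by
        have := c.2
        rw [mem_pc, Fin.sum_univ_succ] at this
        exact CharTwo.add_eq_zero.1 this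
      have h1 : φ c = ∑ i : Fin 7, c.1 i.succ • (f 0 + f i.succ) := by
        change Φ c.1 = _
        rw [hΦ, Fin.sum_univ_succ, hc]
        simp only [smul_add, Finset.sum_add_distrib, ← Finset.sum_smul]
      rw [h1]
      refine Submodule.sum_mem _ fun i _ => Submodule.smul_mem _ _ (Submodule.subset_span ?_)
      exact hB.hasWeight_add (hfB _) (hfB _) fun h => (Fin.succ_ne_zero i) (hfinj h).symm
    · intro u hu
      obtain ⟨b, hb, b', hb', hne, rfl⟩ := hM u hu
      obtain ⟨i, rfl⟩ := hfsurj b hb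
      obtain ⟨j, rfl⟩ := hfsurj b' hb'
      refine ⟨⟨Pi.single i 1 + Pi.single j 1, ?_⟩, ?_⟩
      · rw [mem_pc]
        simp only [Pi.add_apply, Finset.sum_add_distrib, Finset.sum_pi_single', Finset.mem_univ]
        simp [CharTwo.add_self_eq_zero]
      · change Φ (_ + _) = _
        rw [map_add, hsingle, hsingle]
  rw [← hφ, ← hψ]
  refine isoZero_range_of_hammingNorm_eq φ ψ fun c => ?_
  have h1 : ψ c = fun p => c.1 p.1 := rfl
  have h2 : φ c = ∑ i, c.1 i • f i := hΦ c.1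
  rw [h1, h2, hammingNorm_comp_fst, hammingNorm_sum_of_pairwise _ fun i => c.1 i • f i]
  · have h3 : ∀ i, hammingNorm (c.1 i • f i) = D / 2 * if c.1 i ≠ 0 then 1 else 0 := by
      intro i
      have := hB.1 _ (hfB i)
      have h01 : ∀ t : ZMod 2, t = 0 ∨ t = 1 := by decide
      rcases h01 (c.1 i) with h | h
      · simp [h]
      · simp [h]
        omega
    rw [Finset.sum_congr rfl fun i _ => h3 i, ← Finset.mul_sum, hammingNorm, Finset.card_filter]
  · intro i _ j _ hij
    simp only [smul_mul_smul_comm]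
    rw [(hB.2 (hfB i) (hfB j) fun h => hij (hfinj h)).1, smul_zero]

end Blocks

/-! ### Identities for sums, and a linear equivalence with one prescribed value. -/

lemma add_self_word (x : ι → ZMod 2) : x + x = 0 := add_eq_zero_iff_word.2 rfl

lemma add_add_self_word (x p : ι → ZMod 2) : x + p + p = x := by
  rw [add_assoc, add_self_word, add_zero]

lemma add_add_add_self_word (x y p : ι → ZMod 2) : x + p + (y + p) = x + y := by
  rw [add_add_add_comm, add_self_word, add_zero]

lemma add_mul_self_eq_zero {x p : ι → ZMod 2} (h : p * x = p) : (x + p) * p = 0 := by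
  rw [add_mul, mul_comm x p, h, mul_self_word, add_self_word]

lemma add_mul_add_eq_zero {x y p : ι → ZMod 2} (h : x * y = p) (hx : p * x = p) (hy : p * y = p) :
    (x + p) * (y + p) = 0 := by
  rw [mul_add, add_mul_self_eq_zero hx, add_mul, h, hy, add_self_word, add_zero]

lemma exists_linearEquiv_apply_eq {K V V' : Type*} [Field K] [AddCommGroup V] [Module K V]
    [AddCommGroup V'] [Module K V'] [FiniteDimensional K V] [FiniteDimensional K V']
    (h : Module.finrank K V = Module.finrank K V') {v : V} {v' : V'} (hv : v ≠ 0) (hv' : v' ≠ 0) :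
    ∃ f : V ≃ₗ[K] V', f v = v' := by
  let f₀ := LinearEquiv.ofFinrankEq V V' h
  have hw : f₀ v ≠ 0 := by simpa using hv
  obtain ⟨g, hg⟩ := Submodule.exists_linearEquiv_restrict_eq
    ((LinearEquiv.coord K V' (f₀ v) hw).trans (LinearEquiv.toSpanNonzeroSingleton K V' v' hv'))
  refine ⟨f₀.trans g, ?_⟩
  rw [LinearEquiv.trans_apply, ← hg ⟨f₀ v, Submodule.mem_span_singleton_self _⟩]
  rw [LinearEquiv.trans_apply, LinearEquiv.coord_self, LinearEquiv.toSpanNonzeroSingleton_one]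

/-! ### A splitting word of weight 2D: the Reed-Muller case. -/

section ReedMullerCase

variable [Fintype ι] {C : BinaryCode ι} {D : ℕ}

lemma HasWeight.add_of_mul_eq {U x : ι → ZMod 2} (hU : C.HasWeight (2 * D) U)
    (hx : C.HasWeight D x) (hxU : x * U = x) :
    C.HasWeight D (x + U) ∧ (x + U) * U = x + U := by
  refine ⟨⟨C.add_mem hx.1 hU.1, ?_⟩, by rw [add_mul, hxU, mul_self_word]⟩
  have := hammingNorm_add_add x U
  rw [hxU, hx.2, hU.2] at this
  omega

/-- Two disjoint words of weight D inside U fill it and sum to U; two that meet sum to another such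
word. Adding U complements within U. -/
lemma exists_code_inside (hD : 0 < D) (hdiv : C.Divisible D) {U : ι → ZMod 2}
    (hU : C.HasWeight (2 * D) U) :
    ∃ W : BinaryCode ι, (∀ x, x ∈ W ↔ x = 0 ∨ x = U ∨ (C.HasWeight D x ∧ x * U = x)) ∧
      {x | C.HasWeight D x ∧ x * U = x}.ncard + 2 = 2 ^ Module.finrank (ZMod 2) W := by
  have hU0 : U ≠ 0 := hU.ne_zero (by omega)
  set T := {x | C.HasWeight D x ∧ x * U = x} with hT
  have hUT : U ∉ T := by
    intro h
    have h1 := h.1.2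
    rw [hU.2] at h1
    omega
  have h0T : (0 : ι → ZMod 2) ∉ insert U T := by
    rintro (h | h)
    · exact hU0 h.symm
    · exact h.1.ne_zero hD rfl
  have hadd : ∀ x ∈ insert U T, ∀ y ∈ insert U T, x ≠ y → x + y ∈ insert U T := by
    rintro x (rfl | hx) y (rfl | hy) hxy
    · exact absurd rfl hxy
    · rw [add_comm]
      exact Or.inr (hU.add_of_mul_eq hy.1 hy.2)
    · exact Or.inr (hU.add_of_mul_eq hx.1 hx.2)
    · rcases hx.1.mul_eq_zero_or hD hdiv hy.1 hxy with h | h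
      · left
        have h1 : U * (x + y) = U := by
          refine mul_eq_of_hammingNorm_eq ?_
          rw [mul_comm, add_mul, hx.2, hy.2, hammingNorm_add_of_mul_eq_zero h, hx.1.2, hy.1.2, hU.2]
          omega
        rw [mul_comm, add_mul, hx.2, hy.2] at h1
        exact h1
      · exact Or.inr ⟨h.2, by rw [add_mul, hx.2, hy.2]⟩
  obtain ⟨W, hW, hcard⟩ := exists_code_insert_zero h0T hadd
  refine ⟨W, fun x => ?_, ?_⟩
  · rw [hW]
    rfl
  · rw [← hcard, Set.ncard_insert_of_notMem hUT (Set.toFinite _)]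

/-- In the second moment over the support of U only 0 and U contribute, (2D)² each, whereas the
diagonal pairs alone give |W| · 2D. -/
lemma two_pow_le_of_inside (hD : 0 < D) {U : ι → ZMod 2} (hU : hammingNorm U = 2 * D)
    {W : BinaryCode ι} (hUW : U ∈ W)
    (hW : ∀ x ∈ W, x = 0 ∨ x = U ∨ (hammingNorm x = D ∧ x * U = x)) :
    2 ^ Module.finrank (ZMod 2) W ≤ 4 * D := by
  classical
  have : Fintype W := Fintype.ofFinite _
  let I : Finset ι := Finset.univ.filter fun i => U i ≠ 0
  have hI : I.card = 2 * D := hU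
  have hsum : ∀ w : ι → ZMod 2, ∑ i ∈ I, sgn (w i) = (2 * D : ℤ) - 2 * hammingNorm (w * U) := by
    intro w
    have h1 : hammingNorm (w * U) = (I.filter fun i => w i ≠ 0).card := by
      unfold hammingNorm
      congr 1
      ext i
      simp [I, and_comm]
    rw [h1]
    simp only [sgn_eq, Finset.sum_sub_distrib, ← Finset.mul_sum, Finset.sum_boole]
    simp [hI]
  have h := card_mul_le_sum_sq_sum_sgn W I
  have hterm : ∀ w : W, (∑ i ∈ I, sgn (w.1 i)) ^ 2 ≤
      4 * (D : ℤ) ^ 2 * ((if w = 0 then 1 else 0) + (if w = ⟨U, hUW⟩ then 1 else 0)) := by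
    intro w
    rw [hsum]
    rcases hW w.1 w.2 with h | h | ⟨h, h'⟩
    · have : w = 0 := Subtype.ext h
      subst this
      simp only [if_true]
      split_ifs <;> simp <;> nlinarith
    · have : w = ⟨U, hUW⟩ := Subtype.ext h
      subst this
      simp only [if_true, mul_self_word, hU]
      split_ifs <;> push_cast <;> nlinarith
    · rw [h', h]
      split_ifs <;> simp
  have h2 := h.trans (Finset.sum_le_sum fun w _ => hterm w)
  rw [← Finset.mul_sum, Finset.sum_add_distrib] at h2
  simp only [Finset.sum_ite_eq', Finset.mem_univ, if_true, hI] at h2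
  have hC : Fintype.card W = 2 ^ Module.finrank (ZMod 2) W := by
    rw [← ncard_eq_two_pow, ← Nat.card_eq_fintype_card]
    rfl
  rw [hC] at h2
  have h3 : (2 * D) * 2 ^ Module.finrank (ZMod 2) W ≤ (2 * D) * (4 * D) := by
    zify
    push_cast at h2
    linarith
  exact Nat.le_of_mul_le_mul_left h3 (by omega)

/-- Apart from 0 and U, respectively 0 and the all-one word, each code has a single weight, so any
linear bijection taking U to the all-one word will do. -/
lemma weightEquiv_rep_rm {U : ι → ZMod 2} (hU : hammingNorm U = 2 * D) (hU0 : U ≠ 0)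
    {W : BinaryCode ι} (hUW : U ∈ W) (hW : ∀ x ∈ W, x = 0 ∨ x = U ∨ hammingNorm x = D)
    {l m : ℕ} [NeZero m] (hl : Module.finrank (ZMod 2) W = l) (hl2 : 2 ≤ l)
    (hm : m * 2 ^ (l - 2) = D) : WeightEquiv W (rep m (RM l)) := by
  have h1 : (⟨1, one_mem_rm l⟩ : RM l) ≠ 0 := by
    intro h
    exact one_ne_zero (congrArg Subtype.val h)
  obtain ⟨f, hf⟩ := exists_linearEquiv_apply_eq (K := ZMod 2) (v := (⟨U, hUW⟩ : W))
    (v' := (⟨1, one_mem_rm l⟩ : RM l)) (by rw [hl, finrank_rm l (by omega)])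
    (fun h => hU0 (congrArg Subtype.val h)) h1
  refine ⟨f.trans (repEquiv m _), fun c => ?_⟩
  rw [LinearEquiv.trans_apply, hammingNorm_repEquiv]
  by_cases hc0 : c = 0
  · simp [hc0]
  by_cases hcU : c = ⟨U, hUW⟩
  · rw [hcU, hf, hU]
    change m * hammingNorm (1 : (Fin (l - 1) → ZMod 2) → ZMod 2) = _
    rw [hammingNorm_one_rm l hl2, ← hm]
    ring
  · rw [hammingNorm_rm l hl2 _ (f c).2]
    · rcases hW c.1 c.2 with h | h | h
      · exact absurd (Subtype.ext h) hc0
      · exact absurd (Subtype.ext h) hcU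
      · rw [hm, h]
    · intro h
      exact hc0 (f.map_eq_zero_iff.1 (Subtype.ext h))
    · intro h
      exact hcU (f.injective ((Subtype.ext h : f c = ⟨1, one_mem_rm l⟩).trans hf.symm))

lemma weightEquiv_of_constant [Fintype κ] {W : BinaryCode ι} {E : BinaryCode κ}
    (hW : ∀ x ∈ W, x ≠ 0 → hammingNorm x = D) {m w : ℕ} [NeZero m]
    (hE : ∀ x ∈ E, x ≠ 0 → hammingNorm x = w) (hm : m * w = D)
    (h : Module.finrank (ZMod 2) W = Module.finrank (ZMod 2) E) : WeightEquiv W (rep m E) := by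
  let f := LinearEquiv.ofFinrankEq W E h
  refine ⟨f.trans (repEquiv m _), fun c => ?_⟩
  rw [LinearEquiv.trans_apply, hammingNorm_repEquiv]
  by_cases hc0 : c = 0
  · simp [hc0]
  · rw [hE _ (f c).2, hW _ c.2, hm]
    · exact fun h => hc0 (Subtype.ext h)
    · exact fun h => hc0 (f.map_eq_zero_iff.1 (Subtype.ext h))

/-- If the words of weight `D` split along a codeword of weight `2 * D`, they generate the sum of
two first order Reed-Muller codes. -/
theorem isoZero_rm (hD : 0 < D) (hι : Fintype.card ι = 4 * D) (hdiv : C.Divisible D)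
    (hone : 1 ∈ C) {U : ι → ZMod 2} (hU : C.HasWeight (2 * D) U)
    (hsplit : ∀ u, C.HasWeight D u → u * U = u ∨ u * U = 0)
    (hex : ∃ u, C.HasWeight D u ∧ u * U = u) {j : ℕ}
    (hj : {x | C.HasWeight D x}.ncard + 4 = 2 ^ j) :
    ∃ l, 2 ≤ l ∧ j = l + 1 ∧ 2 ^ l ≤ 4 * D ∧ ∀ m, m * 2 ^ (l - 2) = D →
      IsoZero (C.weightSubcode D) (directSum (rep m (RM l)) (rep m (RM l))) := by
  have hV : C.HasWeight (2 * D) (1 + U) := by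
    refine ⟨C.add_mem hone hU.1, ?_⟩
    have h1 := hammingNorm_add_add 1 U
    have h2 : hammingNorm (1 : ι → ZMod 2) = 4 * D := by
      rw [← hι]
      simp [hammingNorm]
    rw [one_mul, h2, hU.2] at h1
    omega
  have hUV : ∀ u, u * (1 + U) = u ↔ u * U = 0 := fun u => by
    rw [mul_add, mul_one, add_eq_left]
  set V := 1 + U with hVdef
  obtain ⟨W₁, hW₁, hc₁⟩ := exists_code_inside hD hdiv hU
  obtain ⟨W₂, hW₂, hc₂⟩ := exists_code_inside hD hdiv hV
  set T₁ := {x | C.HasWeight D x ∧ x * U = x}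
  set T₂ := {x | C.HasWeight D x ∧ x * V = x}
  have hM : {x | C.HasWeight D x} = T₁ ∪ T₂ := by
    ext u
    constructor
    · intro hu
      rcases hsplit u hu with h | h
      · exact Or.inl ⟨hu, h⟩
      · exact Or.inr ⟨hu, (hUV u).2 h⟩
    · rintro (h | h) <;> exact h.1
  have hdisj : Disjoint T₁ T₂ := by
    rw [Set.disjoint_left]
    intro u h1 h2
    have h3 := (hUV u).1 h2.2
    rw [h1.2] at h3
    exact h1.1.ne_zero hD h3
  rw [hM, Set.ncard_union_eq hdisj (Set.toFinite _) (Set.toFinite _)] at hj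
  -- The counts give 2^(dim W₁) + 2^(dim W₂) = 2^j.
  have hl : Module.finrank (ZMod 2) W₁ = Module.finrank (ZMod 2) W₂ :=
    eq_of_two_pow_add_two_pow (j := j) (by omega)
  have hne₁ : 0 < T₁.ncard := (Set.ncard_pos (Set.toFinite _)).2 hex
  obtain ⟨l, hl₁⟩ : ∃ l, Module.finrank (ZMod 2) W₁ = l := ⟨_, rfl⟩
  rw [← hl, hl₁] at hc₂
  rw [hl₁] at hc₁
  have hl2 : 2 ≤ l := by
    rcases two_pow_cases l with h | h | h | h <;> omega
  have hjl : j = l + 1 := by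
    refine Nat.pow_right_injective le_rfl (a₁ := j) (a₂ := l + 1) ?_
    simp only [pow_succ]
    omega
  have hne₂ : 0 < T₂.ncard := by omega
  have hspan : ∀ {X : ι → ZMod 2} {W : BinaryCode ι}, C.HasWeight (2 * D) X →
      (∀ x, x ∈ W ↔ x = 0 ∨ x = X ∨ (C.HasWeight D x ∧ x * X = x)) →
      (∃ x, C.HasWeight D x ∧ x * X = x) → W ≤ C.weightSubcode D := by
    rintro X W hX hW ⟨y, hy, hyX⟩ x hx
    rcases (hW x).1 hx with rfl | rfl | h
    · exact Submodule.zero_mem _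
    · have h1 : x = y + (y + x) := by
        rw [← add_assoc, add_self_word, zero_add]
      rw [h1]
      exact Submodule.add_mem _ (Submodule.subset_span hy)
        (Submodule.subset_span (hX.add_of_mul_eq hy hyX).1)
    · exact Submodule.subset_span h.1
  have hsup : W₁ ⊔ W₂ = C.weightSubcode D := by
    refine le_antisymm (sup_le (hspan hU hW₁ hex)
      (hspan hV hW₂ ((Set.ncard_pos (Set.toFinite _)).1 hne₂))) (Submodule.span_le.2 ?_)
    intro u hu
    rcases hsplit u hu with h | h
    · exact Submodule.mem_sup_left ((hW₁ u).2 (Or.inr (Or.inr ⟨hu, h⟩)))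
    · exact Submodule.mem_sup_right ((hW₂ u).2 (Or.inr (Or.inr ⟨hu, (hUV u).2 h⟩)))
  have hin : ∀ {X : ι → ZMod 2} {W : BinaryCode ι},
      (∀ x, x ∈ W ↔ x = 0 ∨ x = X ∨ (C.HasWeight D x ∧ x * X = x)) → ∀ x ∈ W, x * X = x := by
    intro X W hW x hx
    rcases (hW x).1 hx with rfl | rfl | h
    · simp
    · exact mul_self_word _
    · exact h.2
  refine ⟨l, hl2, hjl, ?_, fun m hm => ?_⟩
  · rw [← hl₁]
    refine two_pow_le_of_inside hD hU.2 ((hW₁ U).2 (Or.inr (Or.inl rfl))) fun x hx => ?_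
    exact ((hW₁ x).1 hx).imp_right (Or.imp_right fun h => ⟨h.1.2, h.2⟩)
  · have : NeZero m := ⟨by rintro rfl; omega⟩
    rw [← hsup]
    refine isoZero_sup_directSum ?_ ?_ ?_
    · exact weightEquiv_rep_rm hU.2 (hU.ne_zero (by omega)) ((hW₁ U).2 (Or.inr (Or.inl rfl)))
        (fun x hx => ((hW₁ x).1 hx).imp_right (Or.imp_right fun h => h.1.2)) hl₁ hl2 hm
    · exact weightEquiv_rep_rm hV.2 (hV.ne_zero (by omega)) ((hW₂ V).2 (Or.inr (Or.inl rfl)))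
        (fun x hx => ((hW₂ x).1 hx).imp_right (Or.imp_right fun h => h.1.2)) (hl.symm.trans hl₁)
        hl2 hm
    · intro x hx y hy
      have hUV0 : U * V = 0 := by rw [hVdef, mul_add, mul_one, mul_self_word, add_self_word]
      rw [← hin hW₁ x hx, ← hin hW₂ y hy, mul_mul_mul_comm, hUV0, mul_zero]

end ReedMullerCase

/-! ### Configurations that produce five blocks. -/

section SmallCases

variable [Fintype ι] {C : BinaryCode ι} {D : ℕ}

lemma Blocks.insert_card [DecidableEq ι] (hD : 0 < D) {B : Finset (ι → ZMod 2)}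
    (hB : Blocks C D B) {c : ι → ZMod 2}
    (hc : 2 * hammingNorm c = D) (h : ∀ b ∈ B, c * b = 0 ∧ c + b ∈ C) :
    Blocks C D (insert c B) ∧ (insert c B).card = B.card + 1 := by
  refine ⟨hB.insert_word hc h, Finset.card_insert_of_notMem fun hcB => ?_⟩
  have := (h c hcB).1
  rw [mul_self_word] at this
  exact hB.ne_zero hD hcB this

/-- All nonempty overlaps have size D/2, so s is covered by halves of x and z. As u avoids z, the
intersections of u with s, of s with x and of u with x are one word p. With q = s + p, the five
blocks are p, x + p, q, z + q and u + p. -/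
lemma exists_blocks [DecidableEq ι] (hD : 0 < D) (hdiv : C.Divisible D) {x z s u : ι → ZMod 2}
    (hx : C.HasWeight D x) (hz : C.HasWeight D z) (hs : C.HasWeight D s) (hu : C.HasWeight D u)
    (hxz : x * z = 0) (hsx : s * x ≠ 0) (hsz : s * z ≠ 0) (hus : u * s ≠ 0) (hux : u * x ≠ 0)
    (huz : u * z = 0) (hne : u ≠ x) : ∃ B, Blocks C D B ∧ 5 ≤ B.card := by
  have nsx : 2 * hammingNorm (s * x) = D :=
    ((hs.mul_eq_zero_or hD hdiv hx (by rintro rfl; exact hsz hxz)).resolve_left hsx).1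
  have nsz : 2 * hammingNorm (s * z) = D :=
    ((hs.mul_eq_zero_or hD hdiv hz
      (by rintro rfl; exact hsx (by rw [mul_comm, hxz]))).resolve_left hsz).1
  have nus : 2 * hammingNorm (u * s) = D :=
    ((hu.mul_eq_zero_or hD hdiv hs (by rintro rfl; exact hsz huz)).resolve_left hus).1
  have nux : 2 * hammingNorm (u * x) = D :=
    ((hu.mul_eq_zero_or hD hdiv hx hne).resolve_left hux).1
  have hs1 : s * x + s * z = s := by
    rw [← mul_add]
    refine mul_eq_of_hammingNorm_eq ?_
    rw [mul_add, hammingNorm_add_of_mul_eq_zero (by rw [mul_mul_mul_comm, hxz, mul_zero]), hs.2]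
    omega
  have husx : u * s * x = u * s := by
    conv_rhs => rw [← hs1]
    rw [mul_add, ← mul_assoc, mul_left_comm u s z, huz, mul_zero, add_zero]
  have h1 : u * x * s = u * x :=
    mul_eq_of_hammingNorm_eq (by rw [mul_right_comm, husx]; omega)
  have h2 : s * x * u = s * x :=
    mul_eq_of_hammingNorm_eq (by rw [mul_comm, ← mul_assoc, husx]; omega)
  have e1 : u * x = u * s := by rw [← h1, mul_right_comm, husx]
  have e2 : s * x = u * s := by rw [← h2, mul_comm, ← mul_assoc, husx]
  obtain ⟨p, hp⟩ : ∃ p, p = u * s := ⟨_, rfl⟩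
  rw [← hp] at e1 e2 husx nus
  have hpx : p * x = p := husx
  have hps : p * s = p := by rw [hp, mul_assoc, mul_self_word]
  have hpu : p * u = p := by rw [hp, mul_right_comm, mul_self_word]
  have hpz : p * z = 0 := by rw [hp, mul_right_comm, huz, zero_mul]
  have hsz' : s * z = s + p := by
    rw [e2] at hs1
    conv_rhs => rw [← hs1]
    rw [add_right_comm, add_self_word, zero_add]
  have half : ∀ {y q : ι → ZMod 2}, C.HasWeight D y → q * y = q → 2 * hammingNorm q = D →
      2 * hammingNorm (y + q) = D := by
    intro y q hy hqy hq
    have := hammingNorm_add_add y q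
    rw [mul_comm y q, hqy, hy.2] at this
    omega
  have hsp : 2 * hammingNorm (s + p) = D := half hs hps nus
  have hspz : (s + p) * z = s + p := by rw [add_mul, hpz, add_zero, hsz']
  have hsC := hs.1
  have huC := hu.1
  have hxC := hx.1
  have hzC := hz.1
  have B0 : Blocks C D ∅ := ⟨by simp, by simp⟩
  obtain ⟨B1, c1⟩ := B0.insert_card hD nus (by simp)
  obtain ⟨B2, c2⟩ := B1.insert_card hD (half hx hpx nus) (by
    simp [add_mul_self_eq_zero hpx, add_add_self_word, hxC])
  have hsp_p := add_mul_self_eq_zero hps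
  have hsp_x : (s + p) * (x + p) = 0 := add_mul_add_eq_zero e2 hps hpx
  obtain ⟨B3, c3⟩ := B2.insert_card hD hsp (by
    simp [hsp_p, hsp_x, add_add_self_word, add_add_add_self_word, hsC, C.add_mem hsC hxC])
  obtain ⟨q, hq⟩ : ∃ q, q = s + p := ⟨_, rfl⟩
  have hqp : q + p = s := by rw [hq, add_add_self_word]
  have hqx : q + (x + p) = s + x := by rw [hq, add_add_add_self_word]
  rw [← hq] at hspz hsp hsp_p hsp_x B3 c3
  have hzp : (z + q) * p = 0 := by rw [add_mul, mul_comm z p, hpz, hsp_p, add_zero]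
  have hzx : (z + q) * (x + p) = 0 := by
    rw [add_mul, mul_add, mul_comm z x, mul_comm z p, hxz, hpz, hsp_x, add_zero, add_zero]
  obtain ⟨B4, c4⟩ := B3.insert_card hD (half hz hspz hsp) (by
    simp [hzp, hzx, add_mul_self_eq_zero hspz, add_self_word, add_assoc z q, hqp, hqx, hzC,
      C.add_mem hzC hsC, C.add_mem hzC (C.add_mem hsC hxC)])
  have hup : (u + p) * p = 0 := add_mul_self_eq_zero hpu
  have hux' : (u + p) * (x + p) = 0 := add_mul_add_eq_zero e1 hpu hpx
  have huq : (u + p) * q = 0 := by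
    rw [hq]
    exact add_mul_add_eq_zero hp.symm hpu hps
  have huzq : (u + p) * (z + q) = 0 := by rw [mul_add, add_mul, huz, hpz, huq, add_zero, add_zero]
  have huq' : u + p + q = u + s := by rw [hq, add_add_add_self_word]
  have huzq' : u + p + (z + q) = z + (u + s) := by rw [add_left_comm, huq']
  obtain ⟨B5, c5⟩ := B4.insert_card hD (half hu hpu nus) (by
    simp [hup, hux', huq, huzq, add_add_self_word, add_add_add_self_word, huq', huzq', huC,
      C.add_mem huC hxC, C.add_mem huC hsC, C.add_mem hzC (C.add_mem huC hsC)])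
  exact ⟨_, B5, by rw [c5, c4, c3, c2, c1]; simp⟩

/-- If u avoids y, then y is replaced by its complement y + (x + z) within the union of x and z,
which u does meet. -/
lemma exists_blocks_of_path [DecidableEq ι] (hD : 0 < D) (hdiv : C.Divisible D)
    {x y z u : ι → ZMod 2} (hx : C.HasWeight D x) (hy : C.HasWeight D y) (hz : C.HasWeight D z)
    (hu : C.HasWeight D u) (hxz : x * z = 0) (hyx : y * x ≠ 0) (hyz : y * z ≠ 0) (hux : u * x ≠ 0)
    (huz : u * z = 0) (hne : u ≠ x) : ∃ B, Blocks C D B ∧ 5 ≤ B.card := by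
  by_cases huy : u * y = 0
  · have nyx : 2 * hammingNorm (y * x) = D :=
      ((hy.mul_eq_zero_or hD hdiv hx (by rintro rfl; exact hyz hxz)).resolve_left hyx).1
    have nyz : 2 * hammingNorm (y * z) = D :=
      ((hy.mul_eq_zero_or hD hdiv hz
        (by rintro rfl; exact hyx (by rw [mul_comm, hxz]))).resolve_left hyz).1
    have nU : C.HasWeight (2 * D) (x + z) := by
      refine ⟨C.add_mem hx.1 hz.1, ?_⟩
      rw [hammingNorm_add_of_mul_eq_zero hxz, hx.2, hz.2]
      omega
    have hyU : y * (x + z) = y := by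
      refine mul_eq_of_hammingNorm_eq ?_
      rw [mul_add, hammingNorm_add_of_mul_eq_zero (by rw [mul_mul_mul_comm, hxz, mul_zero]), hy.2]
      omega
    refine exists_blocks hD hdiv hx hz (nU.add_of_mul_eq hy hyU).1 hu hxz ?_ ?_ ?_ hux huz hne
    · rw [add_mul, add_mul, mul_self_word, mul_comm z x, hxz, add_zero]
      intro h
      rw [add_eq_zero_iff_word] at h
      rw [h, hx.2] at nyx
      omega
    · rw [add_mul, add_mul, mul_self_word, hxz, zero_add]
      intro h
      rw [add_eq_zero_iff_word] at h
      rw [h, hz.2] at nyz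
      omega
    · rw [mul_add, mul_add, huy, huz, add_zero, zero_add]
      exact hux
  · exact exists_blocks hD hdiv hx hz hy hu hxz hyx hyz huy hux huz hne

end SmallCases

/-! ### Arithmetic of sums of powers of two. -/

section TwoPowers

/-- The equation is 2^k + 2^l + 2 = 2^j with k ≥ 2 and l ≥ 1, solved only by 4 + 2 + 2 = 8. -/
lemma eq_of_two_pow_add_two_pow_add_two {k l j m n : ℕ} (hk : m + 1 = 2 ^ k) (hl : n + 1 = 2 ^ l)
    (hm : 2 ≤ m) (hn : 0 < n) (h : m + n + 4 = 2 ^ j) : k = 2 ∧ l = 1 ∧ j = 3 := by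
  have h1 := two_pow_cases k
  have h2 := two_pow_cases l
  have h3 := two_pow_cases j
  have h4 : k = 2 ∧ l = 1 ∧ 2 ^ j = 2 ^ 3 := by
    rcases h1 with h1 | h1 | h1 | ⟨-, s, -, h1⟩ <;> rcases h2 with h2 | h2 | h2 | ⟨-, t, -, h2⟩ <;>
      rcases h3 with h3 | h3 | h3 | ⟨-, r, -, h3⟩ <;> omega
  exact ⟨h4.1, h4.2.1, Nat.pow_right_injective le_rfl h4.2.2⟩

lemma even_of_two_le_two_pow {k : ℕ} (h : 2 ≤ 2 ^ k) : 2 ∣ 2 ^ k := by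
  refine dvd_pow_self 2 ?_
  rintro rfl
  simp at h

/-- The left side is 2^k + 2^l + 2^r + 1, which is odd. -/
lemma two_pow_ne_of_three {k l r j m n p : ℕ} (hk : m + 1 = 2 ^ k) (hl : n + 1 = 2 ^ l)
    (hr : p + 1 = 2 ^ r) (hm : 0 < m) (hn : 0 < n) (hp : 0 < p) : m + n + p + 4 ≠ 2 ^ j := by
  intro h
  have h1 := even_of_two_le_two_pow (k := k) (by omega)
  have h2 := even_of_two_le_two_pow (k := l) (by omega)
  have h3 := even_of_two_le_two_pow (k := r) (by omega)
  have h4 := even_of_two_le_two_pow (k := j) (by omega)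
  omega

lemma existsUnique_of_forall_eq {α : Type*} {p : α → Prop} (c : α) (h : ∃ x, p x)
    (hc : ∀ x, p x → x = c) : ∃! x, p x :=
  existsUnique_of_exists_of_unique h fun _ _ hx hy => (hc _ hx).trans (hc _ hy).symm

end TwoPowers

/-! ### Clusters of meeting words: the simplex case and the zero case. -/

section Clusters

variable [Fintype ι] {C : BinaryCode ι} {D : ℕ}

/-- Meeting (having intersecting supports) is transitive on the words of weight `D`. -/
def MeetTransitive (C : BinaryCode ι) (D : ℕ) : Prop :=
  ∀ x y z, C.HasWeight D x → C.HasWeight D y → C.HasWeight D z → x * y ≠ 0 → y * z ≠ 0 → x * z ≠ 0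

/-- No codeword of weight `2 * D` splits the words of weight `D`. -/
def NoSplit (C : BinaryCode ι) (D : ℕ) : Prop :=
  ∀ U, C.HasWeight (2 * D) U → (∃ u, C.HasWeight D u ∧ u * U = u) →
    ∃ u, C.HasWeight D u ∧ u * U ≠ u ∧ u * U ≠ 0

/-- Apply the hypothesis to U = x + z. A word meeting both x and z takes D/2 positions from each and
lies inside U, so the word obtained meets exactly one of them. -/
lemma NoSplit.exists_meet (hS : NoSplit C D) (hD : 0 < D) (hdiv : C.Divisible D)
    {x z : ι → ZMod 2} (hx : C.HasWeight D x) (hz : C.HasWeight D z) (hxz : x * z = 0) :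
    ∃ u, C.HasWeight D u ∧
      ((u * x ≠ 0 ∧ u * z = 0 ∧ u ≠ x) ∨ (u * z ≠ 0 ∧ u * x = 0 ∧ u ≠ z)) := by
  have nU : C.HasWeight (2 * D) (x + z) := by
    refine ⟨C.add_mem hx.1 hz.1, ?_⟩
    rw [hammingNorm_add_of_mul_eq_zero hxz, hx.2, hz.2]
    omega
  have hxU : x * (x + z) = x := by rw [mul_add, hxz, mul_self_word, add_zero]
  have hzU : z * (x + z) = z := by rw [mul_add, mul_comm z x, hxz, mul_self_word, zero_add]
  obtain ⟨u, hu, h1, h2⟩ := hS _ nU ⟨x, hx, hxU⟩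
  have hux : u ≠ x := by
    rintro rfl
    exact h1 hxU
  have huz : u ≠ z := by
    rintro rfl
    exact h1 hzU
  refine ⟨u, hu, ?_⟩
  rcases hu.mul_eq_zero_or hD hdiv hx hux with ha | ha <;>
    rcases hu.mul_eq_zero_or hD hdiv hz huz with hb | hb
  · rw [mul_add, ha, hb, add_zero] at h2
    exact absurd rfl h2
  · refine Or.inr ⟨fun h => ?_, ha, huz⟩
    rw [mul_add, ha, h, add_zero] at h2
    exact h2 rfl
  · refine Or.inl ⟨fun h => ?_, hb, hux⟩
    rw [mul_add, hb, h, add_zero] at h2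
    exact h2 rfl
  · refine absurd (mul_eq_of_hammingNorm_eq ?_) h1
    rw [mul_add, hammingNorm_add_of_mul_eq_zero (by rw [mul_mul_mul_comm, hxz, mul_zero]), hu.2]
    omega

lemma NoSplit.meetTransitive [DecidableEq ι] (hS : NoSplit C D) (hD : 0 < D)
    (hdiv : C.Divisible D) (hB : ∀ B, Blocks C D B → B.card < 5) : MeetTransitive C D := by
  intro x y z hx hy hz hxy hyz hxz
  obtain ⟨u, hu, ⟨h1, h2, h3⟩ | ⟨h1, h2, h3⟩⟩ := hS.exists_meet hD hdiv hx hz hxz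
  · obtain ⟨B, h, h5⟩ := exists_blocks_of_path hD hdiv hx hy hz hu hxz (by rwa [mul_comm]) hyz
      h1 h2 h3
    exact absurd (hB B h) (by omega)
  · obtain ⟨B, h, h5⟩ := exists_blocks_of_path hD hdiv hz hy hx hu (by rwa [mul_comm]) hyz
      (by rwa [mul_comm]) h1 h2 h3
    exact absurd (hB B h) (by omega)

/-- Distinct words of a cluster overlap in D/2 positions, so their sum has weight D and still meets
each of them. -/
lemma MeetTransitive.exists_code (hT : MeetTransitive C D) (hD : 0 < D) (hdiv : C.Divisible D)
    {x : ι → ZMod 2} (hx : C.HasWeight D x) :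
    ∃ W : BinaryCode ι, (∀ u, u ∈ W ↔ u = 0 ∨ (C.HasWeight D u ∧ u * x ≠ 0)) ∧
      {u | C.HasWeight D u ∧ u * x ≠ 0}.ncard + 1 = 2 ^ Module.finrank (ZMod 2) W ∧
      0 < {u | C.HasWeight D u ∧ u * x ≠ 0}.ncard := by
  obtain ⟨W, hW, hc⟩ := exists_code_insert_zero (T := {u | C.HasWeight D u ∧ u * x ≠ 0})
    (fun h => h.1.ne_zero hD rfl) (by
      intro u hu v hv huv
      have h1 := hT u x v hu.1 hx hv.1 hu.2 (by rw [mul_comm]; exact hv.2)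
      obtain ⟨h2, h3⟩ := (hu.1.mul_eq_zero_or hD hdiv hv.1 huv).resolve_left h1
      refine ⟨h3, hT _ u x h3 hu.1 hx (fun h => ?_) hu.2⟩
      rw [add_mul, mul_self_word, add_eq_zero_iff_word, mul_comm] at h
      rw [← h, hu.1.2] at h2
      omega)
  refine ⟨W, hW, hc, (Set.ncard_pos (Set.toFinite _)).2 ⟨x, hx, ?_⟩⟩
  rw [mul_self_word]
  exact hx.ne_zero hD

lemma MeetTransitive.disjoint (hT : MeetTransitive C D) {x z : ι → ZMod 2}
    (hx : C.HasWeight D x) (hz : C.HasWeight D z) (hxz : x * z = 0) {u v : ι → ZMod 2}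
    (hu : C.HasWeight D u) (hv : C.HasWeight D v) (hux : u * x ≠ 0) (hvz : v * z ≠ 0) :
    u * v = 0 := by
  by_contra h
  exact hT x v z hx hv hz (hT x u v hx hu hv (by rwa [mul_comm]) h) hvz hxz

/-- The case in which there are two disjoint words, one of which meets a third word. -/
lemma MeetTransitive.isoZero_sim (hT : MeetTransitive C D) (hD : 0 < D)
    (hι : Fintype.card ι = 4 * D) (hdiv : C.Divisible D) {j : ℕ}
    (hj : {x | C.HasWeight D x}.ncard + 4 = 2 ^ j) {x z u : ι → ZMod 2}
    (hx : C.HasWeight D x) (hz : C.HasWeight D z) (hxz : x * z = 0) (hu : C.HasWeight D u)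
    (hux : u * x ≠ 0) (hne : u ≠ x) :
    2 ∣ D ∧ j = 3 ∧
      IsoZero (C.weightSubcode D) (directSum (rep (D / 2) (Sim 2)) (rep D (Sim 1))) := by
  have hx0 : x * x ≠ 0 := by
    rw [mul_self_word]
    exact hx.ne_zero hD
  have hz0 : z * z ≠ 0 := by
    rw [mul_self_word]
    exact hz.ne_zero hD
  have nux := ((hu.mul_eq_zero_or hD hdiv hx hne).resolve_left hux).1
  have h2D : 2 ∣ D := ⟨_, nux.symm⟩
  obtain ⟨W₁, hW₁, hc₁, hp₁⟩ := hT.exists_code hD hdiv hx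
  obtain ⟨W₂, hW₂, hc₂, hp₂⟩ := hT.exists_code hD hdiv hz
  have htwo : 2 ≤ {u | C.HasWeight D u ∧ u * x ≠ 0}.ncard := by
    refine (Set.ncard_pair hne).ge.trans (Set.ncard_le_ncard ?_ (Set.toFinite _))
    rintro _ (rfl | rfl)
    · exact ⟨hu, hux⟩
    · exact ⟨hx, hx0⟩
  have hdis : ∀ {x z : ι → ZMod 2}, C.HasWeight D x → C.HasWeight D z → x * z = 0 →
      Disjoint {u | C.HasWeight D u ∧ u * x ≠ 0} {u | C.HasWeight D u ∧ u * z ≠ 0} := by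
    intro x z hx hz hxz
    rw [Set.disjoint_left]
    intro v h1 h2
    have := hT.disjoint hx hz hxz h1.1 h1.1 h1.2 h2.2
    rw [mul_self_word] at this
    exact h1.1.ne_zero hD this
  by_cases hall : ∀ v, C.HasWeight D v → v * x ≠ 0 ∨ v * z ≠ 0
  · have hM : {x | C.HasWeight D x} = {u | C.HasWeight D u ∧ u * x ≠ 0} ∪
        {u | C.HasWeight D u ∧ u * z ≠ 0} := by
      ext v
      constructor
      · intro hv
        rcases hall v hv with h | h
        · exact Or.inl ⟨hv, h⟩
        · exact Or.inr ⟨hv, h⟩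
      · rintro (h | h) <;> exact h.1
    rw [hM, Set.ncard_union_eq (hdis hx hz hxz) (Set.toFinite _) (Set.toFinite _)] at hj
    have hf := eq_of_two_pow_add_two_pow_add_two hc₁ hc₂ htwo hp₂ hj
    refine ⟨h2D, hf.2.2, ?_⟩
    have hsup : W₁ ⊔ W₂ = C.weightSubcode D := by
      refine le_antisymm (sup_le ?_ ?_) (Submodule.span_le.2 ?_)
      · intro v hv
        rcases (hW₁ v).1 hv with rfl | h
        · exact Submodule.zero_mem _
        · exact Submodule.subset_span h.1
      · intro v hv
        rcases (hW₂ v).1 hv with rfl | h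
        · exact Submodule.zero_mem _
        · exact Submodule.subset_span h.1
      · intro v hv
        rcases hall v hv with h | h
        · exact Submodule.mem_sup_left ((hW₁ v).2 (Or.inr ⟨hv, h⟩))
        · exact Submodule.mem_sup_right ((hW₂ v).2 (Or.inr ⟨hv, h⟩))
    have : NeZero D := ⟨by omega⟩
    have : NeZero (D / 2) := ⟨by omega⟩
    rw [← hsup]
    refine isoZero_sup_directSum
      (weightEquiv_of_constant (D := D) ?_ hammingNorm_sim_two (by omega)
        (by rw [hf.1, finrank_sim]))
      (weightEquiv_of_constant (D := D) ?_ hammingNorm_sim_one (by omega)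
        (by rw [hf.2.1, finrank_sim])) ?_
    · intro v hv hv0
      exact (((hW₁ v).1 hv).resolve_left hv0).1.2
    · intro v hv hv0
      exact (((hW₂ v).1 hv).resolve_left hv0).1.2
    · intro v hv w hw
      rcases (hW₁ v).1 hv with rfl | h
      · simp
      rcases (hW₂ w).1 hw with rfl | h'
      · simp
      exact hT.disjoint hx hz hxz h.1 h'.1 h.2 h'.2
  · exfalso
    push Not at hall
    obtain ⟨v, hv, hvx, hvz⟩ := hall
    have hv0 : v * v ≠ 0 := by
      rw [mul_self_word]
      exact hv.ne_zero hD
    obtain ⟨W₃, hW₃, hc₃, hp₃⟩ := hT.exists_code hD hdiv hv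
    have hM : {x | C.HasWeight D x} = ({u | C.HasWeight D u ∧ u * x ≠ 0} ∪
        {u | C.HasWeight D u ∧ u * z ≠ 0}) ∪ {u | C.HasWeight D u ∧ u * v ≠ 0} := by
      ext w
      constructor
      · intro hw
        by_cases h1 : w * x = 0
        · by_cases h2 : w * z = 0
          · by_cases h3 : w * v = 0
            · exfalso
              have huz : u * z = 0 := hT.disjoint hx hz hxz hu hz hux hz0
              have huv : u * v = 0 := hT.disjoint hx hv (by rwa [mul_comm]) hu hv hux hv0
              have hw0 : w * w ≠ 0 := by
                rw [mul_self_word]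
                exact hw.ne_zero hD
              have huw : u * w = 0 := hT.disjoint hx hw (by rwa [mul_comm]) hu hw hux hw0
              -- A fourth cluster does not fit: u + (x + u * x) is the union of u and x, of weight
              -- 3D/2, and with z, v and w this needs 9D/2 > 4D positions.
              have g1 := hammingNorm_add_add u (x + u * x)
              rw [mul_add, ← mul_assoc, mul_self_word, add_self_word, hammingNorm_zero] at g1
              have g2 := hammingNorm_add_add x (u * x)
              rw [mul_left_comm, mul_self_word] at g2
              have g3 : hammingNorm (z + (v + w)) = 3 * D := by
                rw [hammingNorm_add_of_mul_eq_zero, hammingNorm_add_of_mul_eq_zero, hz.2, hv.2,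
                  hw.2]
                · omega
                · rwa [mul_comm]
                · rw [mul_add, mul_comm z v, mul_comm z w, hvz, h2, add_zero]
              have g4 : (u + (x + u * x)) * (z + (v + w)) = 0 := by
                have q1 : u * (z + (v + w)) = 0 := by
                  rw [mul_add, mul_add, huz, huv, huw, add_zero, add_zero]
                have q2 : x * (z + (v + w)) = 0 := by
                  rw [mul_add, mul_add, hxz, mul_comm x v, hvx, mul_comm x w, h1, add_zero,
                    add_zero]
                rw [add_mul, add_mul, mul_assoc u x, q1, q2, mul_zero, add_zero, add_zero]
              have g5 := hammingNorm_add_of_mul_eq_zero g4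
              have g6 : hammingNorm (u + (x + u * x) + (z + (v + w))) ≤ _ :=
                hammingNorm_le_card_fintype
              have := hu.2
              have := hx.2
              omega
            · exact Or.inr ⟨hw, h3⟩
          · exact Or.inl (Or.inr ⟨hw, h2⟩)
        · exact Or.inl (Or.inl ⟨hw, h1⟩)
      · rintro ((h | h) | h) <;> exact h.1
    rw [hM, Set.ncard_union_eq _ (Set.toFinite _) (Set.toFinite _),
      Set.ncard_union_eq (hdis hx hz hxz) (Set.toFinite _) (Set.toFinite _)] at hj
    · exact two_pow_ne_of_three hc₁ hc₂ hc₃ hp₁ hp₂ hp₃ hj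
    · rw [Set.disjoint_union_left]
      exact ⟨hdis hx hv (by rwa [mul_comm]), hdis hz hv (by rwa [mul_comm])⟩

lemma isoZero_of_no_blocks_of_noSplit [DecidableEq ι] (hD : 0 < D)
    (hι : Fintype.card ι = 4 * D) (hdiv : C.Divisible D) {j : ℕ}
    (hj : {x | C.HasWeight D x}.ncard + 4 = 2 ^ j) (hB : ∀ B, Blocks C D B → B.card < 5)
    (hS : NoSplit C D) :
    (2 ∣ D ∧ j = 3 ∧
      IsoZero (C.weightSubcode D) (directSum (rep (D / 2) (Sim 2)) (rep D (Sim 1)))) ∨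
    (j = 2 ∧ IsoZero (C.weightSubcode D) (⊥ : BinaryCode (Fin 0))) := by
  have hT := hS.meetTransitive hD hdiv hB
  by_cases hex : ∃ x, C.HasWeight D x
  · left
    obtain ⟨x, hx⟩ := hex
    -- A single cluster would give 2^r + 3 = 2^j, hence r = 0, but the cluster of x is nonempty.
    obtain ⟨z, hz, hzx⟩ : ∃ z, C.HasWeight D z ∧ z * x = 0 := by
      by_contra! hall
      obtain ⟨W, hW, hc, hp⟩ := hT.exists_code hD hdiv hx
      have hM : {u | C.HasWeight D u ∧ u * x ≠ 0} = {x | C.HasWeight D x} := by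
        ext u
        exact ⟨fun h => h.1, fun h => ⟨h, hall u h⟩⟩
      rw [hM] at hc hp
      have hl := two_pow_cases (Module.finrank (ZMod 2) W)
      have hjj := two_pow_cases j
      omega
    rw [mul_comm] at hzx
    obtain ⟨u, hu, ⟨h1, h2, h3⟩ | ⟨h1, h2, h3⟩⟩ := hS.exists_meet hD hdiv hx hz hzx
    · exact hT.isoZero_sim hD hι hdiv hj hx hz hzx hu h1 h3
    · exact hT.isoZero_sim hD hι hdiv hj hz hx (by rwa [mul_comm]) hu h1 h3
  · right
    push Not at hex
    have hM : {x | C.HasWeight D x} = ∅ := Set.eq_empty_of_forall_notMem hex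
    refine ⟨?_, ?_⟩
    · rw [hM, Set.ncard_empty] at hj
      exact Nat.pow_right_injective le_rfl (a₁ := j) (a₂ := 2) hj.symm
    · have h1 : C.weightSubcode D = ⊥ := by
        change Submodule.span _ {x | C.HasWeight D x} = ⊥
        rw [hM, Submodule.span_empty]
      have := isoZero_range_of_hammingNorm_eq (V := Fin 0 → ZMod 2) (0 : _ →ₗ[ZMod 2] ι → ZMod 2)
        (0 : _ →ₗ[ZMod 2] Fin 0 → ZMod 2)
        (by simp [hammingNorm])
      rwa [LinearMap.range_zero, LinearMap.range_zero, ← h1] at this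

end Clusters

end BinaryCode

/-! ### Assembly of the four cases. -/

theorem mainTheorem5 (a k : ℕ) (C : BinaryCode (Fin (4 * 2 ^ a)))
    (hdim : Module.finrank (ZMod 2) C = k)
    (hproj : C.Projective)
    (hdiv : C.Divisible (2 ^ a))
    (hone : (fun _ => 1) ∈ C) :
    ∃! i : Fin 4,
      (![
        -- (i)
        1 ≤ a ∧ IsoZero (C.weightSubcode (2 ^ a)) (rep (2 ^ a / 2) (PC 7)) ∧ k = a + 6,
        -- (ii)
        ∃ ℓ : ℕ, 2 ≤ ℓ ∧ ℓ ≤ a + 2 ∧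
          IsoZero (C.weightSubcode (2 ^ a))
            (directSum (rep (2 ^ a / 2 ^ (ℓ - 2)) (RM ℓ)) (rep (2 ^ a / 2 ^ (ℓ - 2)) (RM ℓ))) ∧
          k = a + ℓ + 2,
        -- (iii)
        1 ≤ a ∧
          IsoZero (C.weightSubcode (2 ^ a))
            (directSum (rep (2 ^ a / 2) (Sim 2)) (rep (2 ^ a) (Sim 1))) ∧
          k = a + 4,
        -- (iv)
        IsoZero (C.weightSubcode (2 ^ a)) (⊥ : BinaryCode (Fin 0)) ∧ k = a + 3] :
        Fin 4 → Prop) i := by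
  have hD : 0 < 2 ^ a := by positivity
  have hι : Fintype.card (Fin (4 * 2 ^ a)) = 4 * 2 ^ a := Fintype.card_fin _
  have ha : 2 ∣ 2 ^ a → 1 ≤ a := by
    intro h
    by_contra hc
    obtain rfl : a = 0 := by omega
    simp at h
  have hhalf : 1 ≤ a → 2 ^ a / 2 ≠ 0 := by
    intro h
    obtain ⟨b, rfl⟩ : ∃ b, a = b + 1 := ⟨a - 1, by omega⟩
    rw [pow_succ, Nat.mul_div_cancel _ (by norm_num)]
    positivity
  have hcount := ncard_hasWeight_add_four hD hι hproj hdiv hone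
  rw [hdim, ← pow_succ'] at hcount
  have hak : a + 1 ≤ k := (Nat.pow_dvd_pow_iff_le_right (x := 2) (by norm_num)).1
    ⟨_, by rw [← hcount, mul_comm]⟩
  obtain ⟨j, rfl⟩ : ∃ j, k = a + 1 + j := ⟨k - (a + 1), by omega⟩
  have hj : {x | C.HasWeight (2 ^ a) x}.ncard + 4 = 2 ^ j := by
    rw [pow_add 2 (a + 1), mul_comm] at hcount
    exact Nat.eq_of_mul_eq_mul_left (by positivity) hcount
  -- The dimension of C' names the case; the default branch is (ii), where it is 2ℓ with ℓ ≥ 2 and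
  -- so never 7, 3 or 0.
  refine existsUnique_of_forall_eq
    (if Module.finrank (ZMod 2) (C.weightSubcode (2 ^ a)) = 7 then 0 else
      if Module.finrank (ZMod 2) (C.weightSubcode (2 ^ a)) = 3 then 2 else
      if Module.finrank (ZMod 2) (C.weightSubcode (2 ^ a)) = 0 then 3 else 1) ?_ ?_
  · by_cases hB : ∃ B, Blocks C (2 ^ a) B ∧ 5 ≤ B.card
    · obtain ⟨B, hB, h5⟩ := hB
      obtain ⟨B', hB', h8, hj5, hM⟩ := hB.exists_eight hD hι hdiv h5 hj
      refine ⟨0, ha ?_, hB'.isoZero_pc h8 hM, by omega⟩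
      obtain ⟨b, hb⟩ := Finset.card_pos.1 (show 0 < B'.card by omega)
      exact ⟨_, (hB'.1 b hb).symm⟩
    push Not at hB
    by_cases hS : NoSplit C (2 ^ a)
    · rcases isoZero_of_no_blocks_of_noSplit hD hι hdiv hj hB hS with ⟨h1, h2, h3⟩ | ⟨h1, h2⟩
      · exact ⟨2, ha h1, h3, by omega⟩
      · exact ⟨3, h2, by omega⟩
    · unfold NoSplit at hS
      push Not at hS
      obtain ⟨U, hU, hex, hsplit⟩ := hS
      obtain ⟨l, hl, hjl, hle, hiso⟩ := isoZero_rm hD hι hdiv hone hU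
        (fun u hu => or_iff_not_imp_left.2 (hsplit u hu)) hex hj
      have hla : l ≤ a + 2 := by
        refine (Nat.pow_le_pow_iff_right (a := 2) (by norm_num)).1 ?_
        rw [pow_add]
        omega
      refine ⟨1, l, hl, hla, hiso _ ?_, by omega⟩
      exact Nat.div_mul_cancel (Nat.pow_dvd_pow 2 (by omega))
  · intro i hi
    fin_cases i
    · obtain ⟨h1, h2, -⟩ := hi
      rw [h2.finrank_eq, finrank_rep _ (hhalf h1), finrank_pc]
      rfl
    · obtain ⟨l, hl, hla, h2, -⟩ := hi
      have hm : 2 ^ a / 2 ^ (l - 2) ≠ 0 :=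
        (Nat.div_pos (Nat.pow_le_pow_right (by norm_num) (by omega)) (by positivity)).ne'
      rw [h2.finrank_eq, finrank_directSum, finrank_rep _ hm, finrank_rm l (by omega),
        if_neg (by omega), if_neg (by omega), if_neg (by omega)]
      rfl
    · obtain ⟨h1, h2, -⟩ := hi
      rw [h2.finrank_eq, finrank_directSum, finrank_rep _ (hhalf h1), finrank_rep _ hD.ne',
        finrank_sim, finrank_sim]
      rfl
    · obtain ⟨h2, -⟩ := hi
      rw [h2.finrank_eq, finrank_bot]
      rfl
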